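/- A \emph{closed curve} on $\mathbb S^2=\{x\in\mathbb R^3:\|x\|=1\}$ is a continuous, piecewise smooth map $\gamma:[0,L]\to\mathbb S^2$ with $\gamma(0)=\gamma(L)$; put $\int_\gamma p=\int_0^L p(\gamma(\alpha))\,\|\dot\gamma(\alpha)\|\,d\alpha$ and $\ell(\gamma)=\int_\gamma 1$. For a closed curve $\gamma$, a finite nonempty set $X\subseteq\mathbb S^2$ and $\beta\in[0,1]$, the pair $(\gamma,X)$ is a \emph{hybrid $t$-design with balancing constant $\beta$} if $$\frac{\beta}{|X|}\sum_{x\in X}p(x)+\frac{1-\beta}{\ell(\gamma)}\int_\gamma p=\int_{\mathbb S^2}p$$ for all real polynomials $p$ in three variables of total degree at most $t$, where $\int_{\mathbb S^2}$ is taken with respect to the normalized surface measure. Let $\phi=\frac{1+\sqrt5}{2}$, and for $a,b,c\ge 0$ let $[a,b,c]$ denote the set of all points obtained from $(a,b,c)$ by cyclic permutations of the coordinates and arbitrary sign changes. Consider the following convex polytopes in $\mathbb R^3$, given as convex hulls of their vertices: - octahedron: $[1,0,0]$; - cuboctahedron: $[\tfrac1{\sqrt2},\tfrac1{\sqrt2},0]$;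 - rhombic dodecahedron: $[1,0,0]\cup[\tfrac12,\tfrac12,\tfrac12]$; - icosahedron: $[\tfrac{\phi}{2},\tfrac12,0]$; - icosidodecahedron: $[1,0,0]\cup[\tfrac{\phi}{2},\tfrac{1}{2\phi},\tfrac12]$; - rhombic triacontahedron: $[\tfrac{\phi}{2},\tfrac12,0]\cup[\tfrac12,\tfrac12,\tfrac12]\cup[\tfrac{\phi}{2},0,\tfrac1{2\phi}]$. For a polytope $\mathcal P$, an Euler cycle is a closed walk in the graph of its vertices and edges that traverses each edge exactly once. Projecting it outward by $x\mapsto x/\|x\|$ turns each edge into a geodesic arc, and the concatenation of these arcs, parametrized by arc length, is a closed curve on $\mathbb S^2$, the geodesic cycle induced by the Euler cycle. For each of the following four pairs $\mathcal P/\mathcal P'$, the polytope $\mathcal P$ has an Euler cycle, and for every Euler cycle of $\mathcal P$, with induced geodesic cycle $\gamma$, and for $X$ the set of vertices of $\mathcal P'$ projected outward onto $\mathbb S^2$, the pair $(\gamma,X)$ is a hybrid $s$-design with balancing constant $\beta$: - cuboctahedron/rhombic dodecahedron: $s=5$, $\beta=\frac{21}{25}$; - cuboctahedron/octahedron: $s=5$,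 $\beta=\frac15$; - icosidodecahedron/rhombic triacontahedron: $s=9$, $\beta=\frac{45}{49}$; - icosidodecahedron/icosahedron: $s=9$, $\beta=\frac{5}{21}$. -/

import Mathlib

open MeasureTheory Set
open scoped ContDiff goldenRatio

noncomputable section

namespace HybridDesign

/-! ### Curves on the sphere and hybrid designs -/

/-- `γ : [0, L] → 𝕊ⁿ⁻¹` is a closed, continuous, piecewise smooth curve on the unit sphere of
`ℝⁿ` (only the values of `γ` on `[0, L]` matter). -/
structure IsClosedSphericalCurve {n : ℕ} (L : ℝ) (γ : ℝ → EuclideanSpace ℝ (Fin n)) : Prop where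
  pos : 0 < L
  mem_sphere : ∀ α ∈ Icc 0 L, ‖γ α‖ = 1
  continuousOn : ContinuousOn γ (Icc 0 L)
  piecewise_smooth : ∃ (m : ℕ) (τ : Fin (m + 1) → ℝ), StrictMono τ ∧ τ 0 = 0 ∧
    τ (Fin.last m) = L ∧
    ∀ i : Fin m, ContDiffOn ℝ ∞ γ (Icc (τ i.castSucc) (τ i.succ))
  closed : γ 0 = γ L

/-- The path integral `∫_γ f = ∫₀ᴸ f (γ α) ‖γ' α‖ dα`. -/
def pathIntegral {n : ℕ} (L : ℝ) (γ : ℝ → EuclideanSpace ℝ (Fin n))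
    (f : EuclideanSpace ℝ (Fin n) → ℝ) : ℝ :=
  ∫ α in (0 : ℝ)..L, f (γ α) * ‖deriv γ α‖

/-- The arc length `ℓ(γ) = ∫_γ 1`. -/
def arcLength {n : ℕ} (L : ℝ) (γ : ℝ → EuclideanSpace ℝ (Fin n)) : ℝ :=
  pathIntegral L γ fun _ => 1

/-- The integral over the unit sphere of `ℝⁿ` with respect to the normalized surface measure. -/
def sphereIntegral {n : ℕ} (f : EuclideanSpace ℝ (Fin n) → ℝ) : ℝ :=
  ⨍ x : Metric.sphere (0 : EuclideanSpace ℝ (Fin n)) 1, f x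
    ∂(volume : Measure (EuclideanSpace ℝ (Fin n))).toSphere

/-- The pair formed by the closed curve `γ : [0, L] → 𝕊ⁿ⁻¹` and the finite set `X ⊆ 𝕊ⁿ⁻¹` is a
hybrid `t`-design with balancing constant `β`. -/
structure IsHybridDesign {n : ℕ} (t : ℕ) (β L : ℝ) (γ : ℝ → EuclideanSpace ℝ (Fin n))
    (X : Set (EuclideanSpace ℝ (Fin n))) : Prop where
  curve : IsClosedSphericalCurve L γ
  finite : X.Finite
  nonempty : X.Nonempty
  subset_sphere : X ⊆ Metric.sphere 0 1
  beta_mem : β ∈ Icc (0 : ℝ) 1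
  integrates : ∀ p : MvPolynomial (Fin n) ℝ, p.totalDegree ≤ t →
    β / (X.ncard : ℝ) * (∑ᶠ x ∈ X, MvPolynomial.eval (fun i => x i) p)
      + (1 - β) / arcLength L γ * pathIntegral L γ (fun x => MvPolynomial.eval (fun i => x i) p)
      = sphereIntegral (fun x => MvPolynomial.eval (fun i => x i) p)

/-! ### Geodesic arcs and chains -/

/-- The geodesic distance on the unit sphere. -/
def geoDist {n : ℕ} (x y : EuclideanSpace ℝ (Fin n)) : ℝ :=
  Real.arccos (inner ℝ x y)

/-- The geodesic arc from `x` to `y` (unit vectors, `y ≠ ± x`), parametrized by arc length on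
`[0, geoDist x y]`. -/
def geoArc {n : ℕ} (x y : EuclideanSpace ℝ (Fin n)) (s : ℝ) : EuclideanSpace ℝ (Fin n) :=
  (Real.sin (geoDist x y - s) / Real.sin (geoDist x y)) • x
    + (Real.sin s / Real.sin (geoDist x y)) • y

/-- The sum of the geodesic distances between consecutive points of a list. -/
def chainLength {n : ℕ} : List (EuclideanSpace ℝ (Fin n)) → ℝ
  | [] => 0
  | [_] => 0
  | x :: y :: l => geoDist x y + chainLength (y :: l)

/-- The geodesic chain through a list of points: the concatenation of the geodesic arcs between
consecutive points, as a curve on `[0, chainLength l]`. -/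
def chain {n : ℕ} : List (EuclideanSpace ℝ (Fin n)) → ℝ → EuclideanSpace ℝ (Fin n)
  | [], _ => 0
  | [x], _ => x
  | x :: y :: l, α => if α ≤ geoDist x y then geoArc x y α else chain (y :: l) (α - geoDist x y)

/-! ### Polytopes, their vertices and edges, and Euler cycles -/

/-- The graph formed by the vertices and edges of a convex polytope `P`: `a` and `b` are adjacent
if the segment between them is a one-dimensional face of `P`, that is, the set of points of `P` on
a supporting hyperplane. (Points that are not vertices of `P` are isolated in this graph.) -/
def edgeGraph {n : ℕ} (P : Set (EuclideanSpace ℝ (Fin n))) :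
    SimpleGraph (EuclideanSpace ℝ (Fin n)) where
  Adj a b := a ≠ b ∧ IsExposed ℝ P (segment ℝ a b)
  symm := ⟨fun a b h => ⟨h.1.symm, by rw [segment_symm]; exact h.2⟩⟩
  loopless := ⟨fun _ h => h.1 rfl⟩

open Classical in
/-- A closed walk that traverses every edge exactly once. -/
def IsEulerCycle {V : Type*} {G : SimpleGraph V} {v : V} (w : G.Walk v v) : Prop :=
  w.IsEulerian

/-- The vertices of the polytope `P`, projected outward onto the unit sphere. -/
def sphericalVertices {n : ℕ} (P : Set (EuclideanSpace ℝ (Fin n))) :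
    Set (EuclideanSpace ℝ (Fin n)) :=
  NormedSpace.normalize '' extremePoints ℝ P

/-- The successive vertices of a walk along the edges of `P`, projected onto the unit sphere. -/
def sphericalPoints {n : ℕ} {P : Set (EuclideanSpace ℝ (Fin n))} {u v : EuclideanSpace ℝ (Fin n)}
    (w : (edgeGraph P).Walk u v) : List (EuclideanSpace ℝ (Fin n)) :=
  w.support.map NormedSpace.normalize

/-- The edges of `P` admit an Euler cycle, and, for every Euler cycle, the geodesic cycle it
induces on the sphere and the projected vertices of `Q` form a hybrid `t`-design with balancing
constant `β`. -/
def EdgesVerticesHybrid {n : ℕ} (P Q : Set (EuclideanSpace ℝ (Fin n))) (t : ℕ) (β : ℝ) : Prop :=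
  (∃ (v : EuclideanSpace ℝ (Fin n)) (w : (edgeGraph P).Walk v v), IsEulerCycle w) ∧
  ∀ (v : EuclideanSpace ℝ (Fin n)) (w : (edgeGraph P).Walk v v), IsEulerCycle w →
    IsHybridDesign t β (chainLength (sphericalPoints w)) (chain (sphericalPoints w))
      (sphericalVertices Q)

/-! ### The polytopes -/

/-- All points obtained from `(a, b, c)` (with `a, b, c ≥ 0`) by cyclic permutations of the
coordinates and arbitrary sign changes. -/
def signedCyclic (a b c : ℝ) : Set (EuclideanSpace ℝ (Fin 3)) :=
  {x | ∃ k : Fin 3, |x k| = a ∧ |x (k + 1)| = b ∧ |x (k + 2)| = c}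

def octahedron : Set (EuclideanSpace ℝ (Fin 3)) :=
  convexHull ℝ (signedCyclic 1 0 0)

def cuboctahedron : Set (EuclideanSpace ℝ (Fin 3)) :=
  convexHull ℝ (signedCyclic (1 / √2) (1 / √2) 0)

def rhombicDodecahedron : Set (EuclideanSpace ℝ (Fin 3)) :=
  convexHull ℝ (signedCyclic 1 0 0 ∪ signedCyclic (1 / 2) (1 / 2) (1 / 2))

def icosahedron : Set (EuclideanSpace ℝ (Fin 3)) :=
  convexHull ℝ (signedCyclic (φ / 2) (1 / 2) 0)

def icosidodecahedron : Set (EuclideanSpace ℝ (Fin 3)) :=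
  convexHull ℝ (signedCyclic 1 0 0 ∪ signedCyclic (φ / 2) (φ⁻¹ / 2) (1 / 2))

def rhombicTriacontahedron : Set (EuclideanSpace ℝ (Fin 3)) :=
  convexHull ℝ (signedCyclic (φ / 2) (1 / 2) 0 ∪ signedCyclic (1 / 2) (1 / 2) (1 / 2) ∪
    signedCyclic (φ / 2) 0 (φ⁻¹ / 2))

end HybridDesign

end

/-! The four edges at a vertex of the cuboctahedron or icosidodecahedron pair off into two straight
lines on the sphere: the projected edges tile great circles (four hexagons, six decagons), every
edge spanning an angle `2π/N` with `N = 6` or `N = 10`. On a great circle a polynomial of degree `t`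
is a trigonometric polynomial of degree at most `t`, and for `t < N` its mean over the circle equals
its mean over the `N` vertices lying on it. An Euler cycle runs through every edge once, so its path
mean is the mean over the vertex set `V` of the polytope, whichever Euler cycle is chosen
(`IsGeodesicConfiguration.sum_geoArc`, `IsGeodesicConfiguration.mean_pathIntegral`).

What remains is a cubature formula on the sphere with weight `β/|X|` on `X` and `(1-β)/|V|` on `V`.
Conceptually, octahedral (icosahedral) symmetry leaves a single condition up to degree 5 (degree 9),
coming from the invariant harmonic of degree 4 (degree 6), and that condition fixes `β`. The proof
checks monomials instead: those with an odd exponent vanish under sign changes, and the finitely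
many even ones are compared with the sphere moments by exact arithmetic in `ℤ[φ]`
(`CubatureModel.eval`).

The other ingredient is the combinatorics of the convex hulls. Adjacency as an exposed segment is
shown to mean having the largest inner product occurring between distinct vertices
(`IsEdgeConfiguration.edgeGraph_adj`). This makes the edge graph a finite object, on which Euler
cycles can be exhibited and sums over edges computed. `edgesVerticesHybrid_of_models` assembles
everything from decidable conditions on lists of points. -/

noncomputable section

namespace HybridDesign

/-! ### Faces of convex hulls -/

section Faces

variable {n : ℕ}

/-- A convex set `F` on which a functional takes the constant value `M`, together with the open
half-space below `M`, contains the convex hull of every set it contains. -/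
lemma convexHull_subset_lt_union {E : Type*} [AddCommGroup E] [Module ℝ E] (l : E →ₗ[ℝ] ℝ)
    (M : ℝ) {S F : Set E} (hF : Convex ℝ F) (hlF : ∀ x ∈ F, l x = M)
    (hS : ∀ x ∈ S, l x < M ∨ x ∈ F) : ∀ x ∈ convexHull ℝ S, l x < M ∨ x ∈ F := by
  have hconv : Convex ℝ {x | l x < M ∨ x ∈ F} := by
    rw [convex_iff_forall_pos]
    intro x hx y hy a b ha hb hab
    have hlin : l (a • x + b • y) = a * l x + b * l y := by simp
    have hM : M = a * M + b * M := by rw [← add_mul, hab, one_mul]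
    rcases hx with hx | hx
    · left
      have hy' : l y ≤ M := hy.elim le_of_lt fun h => (hlF y h).le
      rw [hlin, hM]
      exact add_lt_add_of_lt_of_le (mul_lt_mul_of_pos_left hx ha)
        (mul_le_mul_of_nonneg_left hy' hb.le)
    · rcases hy with hy | hy
      · left
        rw [hlin, hM, hlF x hx]
        exact add_lt_add_of_le_of_lt le_rfl (mul_lt_mul_of_pos_left hy hb)
      · exact Or.inr (hF hx hy ha.le hb.le hab)
  exact fun x hx => convexHull_min hS hconv hx

/-- Each `v` is the unique maximizer over `S` of the functional `inner ℝ v`, so `{v}` is a face of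
the hull. -/
lemma extremePoints_convexHull_eq {S : Set (EuclideanSpace ℝ (Fin n))}
    (h : ∀ v ∈ S, ∀ w ∈ S, w ≠ v → inner ℝ v w < inner ℝ v v) :
    extremePoints ℝ (convexHull ℝ S) = S := by
  refine Subset.antisymm extremePoints_convexHull_subset fun v hv => ?_
  have key : ∀ x ∈ convexHull ℝ S, inner ℝ v x < inner ℝ v v ∨ x ∈ ({v} : Set _) :=
    convexHull_subset_lt_union (innerₛₗ ℝ v) _ (convex_singleton v)
      (by rintro x rfl; rfl) fun w hw => by
        by_cases hwv : w = v
        · exact Or.inr hwv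
        · exact Or.inl (h v hv w hw hwv)
  rw [mem_extremePoints_iff_left]
  refine ⟨subset_convexHull ℝ S hv, fun x hx y hy hxy => ?_⟩
  by_contra hne
  have hlt := (key x hx).resolve_right hne
  have hle : inner ℝ v y ≤ inner ℝ v v :=
    (key y hy).elim le_of_lt fun h => by rw [mem_singleton_iff.1 h]
  obtain ⟨a, b, ha, hb, hab, hv'⟩ := hxy
  have h1 : a * inner ℝ v x + b * inner ℝ v y = inner ℝ v v := by
    simpa [inner_add_right, inner_smul_right] using congrArg (inner ℝ v) hv'
  have h2 : inner ℝ v v = a * inner ℝ v v + b * inner ℝ v v := by rw [← add_mul, hab, one_mul]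
  linarith [mul_lt_mul_of_pos_left hlt ha, mul_le_mul_of_nonneg_left hle hb.le]

/-- A finite set `V` of unit vectors in which adjacency means having inner product `c`: no two
distinct points are closer, and the segment between two nonadjacent points is no edge of the
convex hull, because some positive combination of them is a combination, with no larger total
weight, of points of `V` that include a third one. -/
structure IsEdgeConfiguration (V : Set (EuclideanSpace ℝ (Fin n))) (c : ℝ) : Prop where
  lt_one : c < 1
  norm_eq_one : ∀ v ∈ V, ‖v‖ = 1
  neg_mem : ∀ v ∈ V, -v ∈ V
  inner_eq_or_lt : ∀ v ∈ V, ∀ w ∈ V, v ≠ w → inner ℝ v w = c ∨ inner ℝ v w < c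
  crossing : ∀ a ∈ V, ∀ b ∈ V, a ≠ b → inner ℝ a b ≠ c →
    ∃ x ∈ V, ∃ y ∈ V, x ≠ a ∧ x ≠ b ∧ ∃ α β ξ η : ℝ, 0 < ξ ∧ 0 ≤ η ∧
      ξ + η ≤ α + β ∧ α • a + β • b = ξ • x + η • y

variable {V : Set (EuclideanSpace ℝ (Fin n))} {c : ℝ}

lemma IsEdgeConfiguration.inner_self (h : IsEdgeConfiguration V c) {v : EuclideanSpace ℝ (Fin n)}
    (hv : v ∈ V) : inner ℝ v v = (1 : ℝ) := by
  rw [real_inner_self_eq_norm_sq, h.norm_eq_one v hv, one_pow]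

lemma IsEdgeConfiguration.extremePoints (h : IsEdgeConfiguration V c) :
    extremePoints ℝ (convexHull ℝ V) = V := by
  refine extremePoints_convexHull_eq fun v hv w hw hwv => ?_
  rw [h.inner_self hv]
  rcases h.inner_eq_or_lt v hv w hw hwv.symm with h1 | h1
  · exact h1 ▸ h.lt_one
  · exact h1.trans h.lt_one

lemma left_mem_extremePoints_segment {E : Type*} [AddCommGroup E] [Module ℝ E] (a b : E) :
    a ∈ extremePoints ℝ (segment ℝ a b) := by
  rw [mem_extremePoints_iff_left]
  refine ⟨left_mem_segment ℝ a b, ?_⟩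
  intro x hx y hy hxy
  by_cases hab : a = b
  · subst hab; simpa using hx
  rw [segment_eq_image_lineMap] at hx hy
  obtain ⟨s, hs, rfl⟩ := hx
  obtain ⟨t, ht, rfl⟩ := hy
  obtain ⟨p, q, hp, hq, hpq, hsum⟩ := hxy
  have h1 : (p * s + q * t) • (b - a) = 0 := by
    have h2 : a = (p + q) • a + (p * s + q * t) • (b - a) := by
      conv_lhs => rw [← hsum]
      simp only [AffineMap.lineMap_apply_module']
      module
    rw [hpq, one_smul] at h2
    simpa using h2.symm
  rcases smul_eq_zero.1 h1 with h0 | h0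
  · have hs0 : s = 0 := by
      have := mul_nonneg hq.le ht.1
      have h3 : p * s ≤ 0 := by linarith
      have h4 := nonpos_of_mul_nonpos_right h3 hp
      exact le_antisymm h4 hs.1
    simp [hs0]
  · exact absurd (sub_eq_zero.1 h0).symm hab

/-- Pairs at inner product `c` are closest pairs, and the functional `a + b` exposes their segment.
For any other pair, `crossing` forces a third point of `V` into each face containing both. -/
lemma IsEdgeConfiguration.edgeGraph_adj (h : IsEdgeConfiguration V c)
    {a b : EuclideanSpace ℝ (Fin n)} :
    (edgeGraph (convexHull ℝ V)).Adj a b ↔ a ∈ V ∧ b ∈ V ∧ inner ℝ a b = c := by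
  constructor
  · rintro ⟨hab, hexp⟩
    have hext := hexp.isExtreme.extremePoints_subset_extremePoints
    rw [h.extremePoints] at hext
    have ha : a ∈ V := hext (left_mem_extremePoints_segment a b)
    have hb : b ∈ V := hext (by rw [segment_symm]; exact left_mem_extremePoints_segment b a)
    refine ⟨ha, hb, ?_⟩
    by_contra hc
    obtain ⟨x, hx, y, hy, hxa, hxb, α, β, ξ, η, hξ, hη, hle, heq⟩ := h.crossing a ha b hb hab hc
    obtain ⟨l, hl⟩ := hexp ⟨a, left_mem_segment ℝ a b⟩
    have hface : ∀ z, z ∈ segment ℝ a b ↔ z ∈ convexHull ℝ V ∧ ∀ y ∈ convexHull ℝ V, l y ≤ l z :=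
      fun z => by rw [hl]; rfl
    have hV := subset_convexHull ℝ V
    have hla := ((hface a).1 (left_mem_segment ℝ a b)).2
    have hlb := ((hface b).1 (right_mem_segment ℝ a b)).2
    have hlab : l b = l a := le_antisymm (hla b (hV hb)) (hlb a (hV ha))
    -- Central symmetry makes the maximum of `l` nonnegative, so the inequality `ξ + η ≤ α + β`
    -- between total weights can be multiplied by it.
    have hla0 : 0 ≤ l a := by
      have := hla _ (hV (h.neg_mem a ha))
      rw [map_neg] at this
      linarith
    have hly := hla y (hV hy)
    have hlc : α * l a + β * l b = ξ * l x + η * l y := by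
      simpa using congrArg l heq
    have hlx : l a ≤ l x := by
      have h1 : η * l y ≤ η * l a := mul_le_mul_of_nonneg_left hly hη
      have h2 : (ξ + η) * l a ≤ (α + β) * l a := mul_le_mul_of_nonneg_right hle hla0
      rw [hlab] at hlc
      have h3 : ξ * l a ≤ ξ * l x := by linarith
      exact le_of_mul_le_mul_left h3 hξ
    -- Now `x` also maximizes `l`, so it lies on the segment; being an extreme point of the hull, it
    -- cannot be interior to it.
    have hxs : x ∈ segment ℝ a b :=
      (hface x).2 ⟨hV hx, fun z hz => (hla z hz).trans hlx⟩
    have hxe : x ∈ Set.extremePoints ℝ (convexHull ℝ V) := by rwa [h.extremePoints]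
    have hxo : x ∈ openSegment ℝ a b := mem_openSegment_of_ne_left_right hxa.symm hxb.symm hxs
    exact hxa.symm (((mem_extremePoints_iff_left.1 hxe).2 a (hV ha) b (hV hb) hxo))
  · rintro ⟨ha, hb, hc⟩
    have hba : inner ℝ b a = c := by rw [real_inner_comm, hc]
    have hab : a ≠ b := by
      rintro rfl
      rw [h.inner_self ha] at hc
      exact h.lt_one.ne hc.symm
    refine ⟨hab, fun _ => ⟨innerSL ℝ (a + b), ?_⟩⟩
    have hval : ∀ x ∈ segment ℝ a b, innerSL ℝ (a + b) x = 1 + c := by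
      rintro x ⟨s, t, -, -, hst, rfl⟩
      simp only [innerSL_apply_apply, inner_add_left, inner_add_right, inner_smul_right,
        h.inner_self ha, h.inner_self hb, hc, hba]
      linear_combination (1 + c) * hst
    have key : ∀ x ∈ convexHull ℝ V,
        innerSL ℝ (a + b) x < 1 + c ∨ x ∈ segment ℝ a b := by
      refine convexHull_subset_lt_union (innerₛₗ ℝ (a + b)) _ (convex_segment a b)
        hval fun v hv => ?_
      by_cases hva : a = v
      · exact Or.inr (hva ▸ left_mem_segment ℝ a b)
      by_cases hvb : b = v
      · exact Or.inr (hvb ▸ right_mem_segment ℝ a b)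
      left
      have h1 : inner ℝ a v ≤ c := (h.inner_eq_or_lt a ha v hv hva).elim le_of_eq le_of_lt
      have h2 : inner ℝ b v ≤ c := (h.inner_eq_or_lt b hb v hv hvb).elim le_of_eq le_of_lt
      have h3 := h.lt_one
      change inner ℝ (a + b) v < 1 + c
      rw [inner_add_left]
      linarith
    have hsub : segment ℝ a b ⊆ convexHull ℝ V :=
      segment_subset_convexHull ha hb
    ext x
    constructor
    · intro hx
      refine ⟨hsub hx, fun y hy => ?_⟩
      rw [hval x hx]
      exact (key y hy).elim le_of_lt fun h => (hval y h).le
    · rintro ⟨hx, hmax⟩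
      refine (key x hx).resolve_left (not_lt.2 ?_)
      rw [← hval a (left_mem_segment ℝ a b)]
      exact hmax a (hsub (left_mem_segment ℝ a b))

end Faces

/-! ### Geodesic chains with arcs of constant length -/

section Chains

variable {n : ℕ}

/-- `x` and `y` are unit vectors at geodesic distance `θ`. -/
def IsArcPair (θ : ℝ) (x y : EuclideanSpace ℝ (Fin n)) : Prop :=
  ‖x‖ = 1 ∧ ‖y‖ = 1 ∧ inner ℝ x y = Real.cos θ

variable {θ : ℝ} {x y : EuclideanSpace ℝ (Fin n)}

lemma IsArcPair.symm (h : IsArcPair θ x y) : IsArcPair θ y x :=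
  ⟨h.2.1, h.1, by rw [real_inner_comm]; exact h.2.2⟩

lemma IsArcPair.geoDist_eq (h : IsArcPair θ x y) (hθ : θ ∈ Ioo 0 Real.pi) : geoDist x y = θ := by
  rw [geoDist, h.2.2, Real.arccos_cos hθ.1.le hθ.2.le]

lemma IsArcPair.geoArc_eq (h : IsArcPair θ x y) (hθ : θ ∈ Ioo 0 Real.pi) (s : ℝ) :
    geoArc x y s = (Real.sin (θ - s) / Real.sin θ) • x + (Real.sin s / Real.sin θ) • y := by
  rw [geoArc, h.geoDist_eq hθ]

/-- Gram–Schmidt applied to `x`, `y` gives `w`. In this form the arc visibly lies on the sphere, has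
unit speed, and has coordinates that are trigonometric polynomials of degree one. -/
lemma IsArcPair.exists_tangent (h : IsArcPair θ x y) (hθ : θ ∈ Ioo 0 Real.pi) :
    ∃ w : EuclideanSpace ℝ (Fin n), ‖w‖ = 1 ∧ inner ℝ x w = (0 : ℝ) ∧
      ∀ s, geoArc x y s = Real.cos s • x + Real.sin s • w := by
  have hsin : Real.sin θ ≠ 0 := (Real.sin_pos_of_pos_of_lt_pi hθ.1 hθ.2).ne'
  have hxx : inner ℝ x x = (1 : ℝ) := by rw [real_inner_self_eq_norm_sq, h.1, one_pow]
  have hyy : inner ℝ y y = (1 : ℝ) := by rw [real_inner_self_eq_norm_sq, h.2.1, one_pow]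
  refine ⟨(Real.sin θ)⁻¹ • (y - Real.cos θ • x), ?_, ?_, fun s => ?_⟩
  · have h1 : inner ℝ ((Real.sin θ)⁻¹ • (y - Real.cos θ • x))
        ((Real.sin θ)⁻¹ • (y - Real.cos θ • x)) = (1 : ℝ) := by
      simp only [inner_smul_left, inner_smul_right, inner_sub_left, inner_sub_right, hxx, hyy,
        h.2.2, h.symm.2.2, RCLike.conj_to_real]
      field_simp
      linear_combination -Real.sin_sq_add_cos_sq θ
    rw [real_inner_self_eq_norm_sq] at h1
    exact (pow_eq_one_iff_of_nonneg (norm_nonneg _) two_ne_zero).1 h1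
  · rw [inner_smul_right, inner_sub_right, inner_smul_right, hxx, h.2.2]
    ring
  · rw [h.geoArc_eq hθ, Real.sin_sub]
    match_scalars
    · field_simp
      ring
    · field_simp

lemma IsArcPair.geoArc_zero (h : IsArcPair θ x y) (hθ : θ ∈ Ioo 0 Real.pi) :
    geoArc x y 0 = x := by
  obtain ⟨w, -, -, hw⟩ := h.exists_tangent hθ
  simp [hw]

lemma IsArcPair.geoArc_symm (h : IsArcPair θ x y) (hθ : θ ∈ Ioo 0 Real.pi) (s : ℝ) :
    geoArc y x s = geoArc x y (θ - s) := by
  rw [h.geoArc_eq hθ, h.symm.geoArc_eq hθ, sub_sub_cancel, add_comm]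

lemma IsArcPair.geoArc_end (h : IsArcPair θ x y) (hθ : θ ∈ Ioo 0 Real.pi) :
    geoArc x y θ = y := by
  rw [← sub_zero θ, ← h.geoArc_symm hθ, h.symm.geoArc_zero hθ]

/-- Continuing the arc from `x` to `y` beyond `y` by the same distance. -/
lemma IsArcPair.geoArc_add (h : IsArcPair θ x y) (hθ : θ ∈ Ioo 0 Real.pi)
    (h' : IsArcPair θ y ((2 * Real.cos θ) • y - x)) (s : ℝ) :
    geoArc y ((2 * Real.cos θ) • y - x) s = geoArc x y (s + θ) := by
  have hsin : Real.sin θ ≠ 0 := (Real.sin_pos_of_pos_of_lt_pi hθ.1 hθ.2).ne'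
  rw [h.geoArc_eq hθ, h'.geoArc_eq hθ, Real.sin_sub θ (s + θ), Real.sin_add, Real.cos_add,
    Real.sin_sub]
  match_scalars
  · field_simp
    ring
  · field_simp
    linear_combination Real.sin s * Real.sin_sq_add_cos_sq θ

lemma contDiff_geoArc : ContDiff ℝ ∞ (geoArc x y) := by
  unfold geoArc
  fun_prop

lemma IsArcPair.norm_geoArc (h : IsArcPair θ x y) (hθ : θ ∈ Ioo 0 Real.pi) (s : ℝ) :
    ‖geoArc x y s‖ = 1 := by
  obtain ⟨w, hw1, hw0, hw⟩ := h.exists_tangent hθ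
  have h1 : ‖geoArc x y s‖ ^ 2 = 1 := by
    rw [hw, norm_add_sq_real, norm_smul, norm_smul, h.1, hw1, inner_smul_left, inner_smul_right,
      hw0]
    simp
  exact (pow_eq_one_iff_of_nonneg (norm_nonneg _) two_ne_zero).1 h1

lemma IsArcPair.norm_deriv_geoArc (h : IsArcPair θ x y) (hθ : θ ∈ Ioo 0 Real.pi) (s : ℝ) :
    ‖deriv (geoArc x y) s‖ = 1 := by
  obtain ⟨w, hw1, hw0, hw⟩ := h.exists_tangent hθ
  have hd : HasDerivAt (geoArc x y) ((-Real.sin s) • x + Real.cos s • w) s := by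
    rw [funext hw]
    exact ((Real.hasDerivAt_cos s).smul_const x).add ((Real.hasDerivAt_sin s).smul_const w)
  have h1 : ‖deriv (geoArc x y) s‖ ^ 2 = 1 := by
    rw [hd.deriv, norm_add_sq_real, norm_smul, norm_smul, h.1, hw1, inner_smul_left,
      inner_smul_right, hw0]
    simp
  exact (pow_eq_one_iff_of_nonneg (norm_nonneg _) two_ne_zero).1 h1

variable {l : List (EuclideanSpace ℝ (Fin n))}

lemma chainLength_eq (hθ : θ ∈ Ioo 0 Real.pi) (hl : l.IsChain (IsArcPair θ)) :
    chainLength l = ((l.length - 1 : ℕ) : ℝ) * θ := by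
  induction l with
  | nil => simp [chainLength]
  | cons x l ih =>
    cases l with
    | nil => simp [chainLength]
    | cons y l =>
      rw [chainLength, ih hl.of_cons, hl.rel.geoDist_eq hθ]
      simp
      ring

lemma chain_zero (hθ : θ ∈ Ioo 0 Real.pi) (hl : (x :: l).IsChain (IsArcPair θ)) :
    chain (x :: l) 0 = x := by
  cases l with
  | nil => rfl
  | cons y l =>
    rw [chain, if_pos (by rw [hl.rel.geoDist_eq hθ]; exact hθ.1.le), hl.rel.geoArc_zero hθ]

lemma continuous_chain (hθ : θ ∈ Ioo 0 Real.pi) (hl : l.IsChain (IsArcPair θ)) :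
    Continuous (chain l) := by
  induction l with
  | nil => exact continuous_const
  | cons x l ih =>
    cases l with
    | nil => exact continuous_const
    | cons y l =>
      change Continuous fun α => if α ≤ geoDist x y then geoArc x y α else
        chain (y :: l) (α - geoDist x y)
      rw [hl.rel.geoDist_eq hθ]
      refine contDiff_geoArc.continuous.if_le ((ih hl.of_cons).comp (by fun_prop)) continuous_id
        continuous_const ?_
      intro α hα
      rw [show α = θ from hα, hl.rel.geoArc_end hθ, sub_self, chain_zero hθ hl.of_cons]

/-- Closed intervals are allowed because consecutive arcs agree at their common corner. The default
`0` of `getD` is never reached. -/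
lemma chain_eq_geoArc (hθ : θ ∈ Ioo 0 Real.pi) (hl : l.IsChain (IsArcPair θ)) {i : ℕ}
    (hi : i + 1 < l.length) {α : ℝ} (hα : α ∈ Icc (i * θ) ((i + 1) * θ)) :
    chain l α = geoArc (l.getD i 0) (l.getD (i + 1) 0) (α - i * θ) := by
  induction l generalizing i α with
  | nil => simp at hi
  | cons x l ih =>
    cases l with
    | nil => simp at hi
    | cons y l =>
      rw [chain, hl.rel.geoDist_eq hθ]
      cases i with
      | zero =>
        rw [if_pos (by simpa using hα.2)]
        simp
      | succ i =>
        have hi' : i + 1 < (y :: l).length := by simpa using hi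
        have hα' : α - θ ∈ Icc (i * θ) ((i + 1) * θ) := by
          obtain ⟨h1, h2⟩ := hα
          push_cast at h1 h2
          constructor <;> linarith
        have := ih hl.of_cons hi' hα'
        have hshift : α - θ - i * θ = α - (i + 1 : ℕ) * θ := by push_cast; ring
        rw [List.getD_cons_succ, List.getD_cons_succ, ← hshift, ← this]
        -- The `≤` in `chain` gives the corner `α = θ` to the earlier arc; both arcs take the value
        -- `y` there.
        split_ifs with hle
        · have h0 : α - θ = 0 := by
            have := mul_nonneg (Nat.cast_nonneg (α := ℝ) i) hθ.1.le
            linarith [hα'.1]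
          rw [h0, chain_zero hθ hl.of_cons, sub_eq_zero.1 h0, hl.rel.geoArc_end hθ]
        · rfl

lemma isArcPair_getD (hl : l.IsChain (IsArcPair θ)) {i : ℕ} (hi : i + 1 < l.length) :
    IsArcPair θ (l.getD i 0) (l.getD (i + 1) 0) := by
  rw [List.getD_eq_getElem _ _ hi, List.getD_eq_getElem _ _ (by omega)]
  exact List.isChain_iff_getElem.1 hl i hi

lemma exists_mem_Icc_mul {m : ℕ} (hθ : 0 < θ) (hm : 0 < m) {α : ℝ} (hα : α ∈ Icc 0 (m * θ)) :
    ∃ i < m, α ∈ Icc (i * θ) ((i + 1) * θ) := by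
  rcases hα.2.eq_or_lt with rfl | hlt
  -- At the right end the floor would be `m`, one too many.
  · refine ⟨m - 1, by omega, ?_⟩
    rw [Nat.cast_pred hm]
    constructor <;> nlinarith
  · refine ⟨⌊α / θ⌋₊, ?_, ?_, ?_⟩
    · rw [Nat.floor_lt (div_nonneg hα.1 hθ.le), div_lt_iff₀ hθ]
      exact hlt
    · rw [← le_div_iff₀ hθ]
      exact Nat.floor_le (div_nonneg hα.1 hθ.le)
    · rw [← div_le_iff₀ hθ]
      exact (Nat.lt_floor_add_one _).le

lemma isClosedSphericalCurve_chain (hθ : θ ∈ Ioo 0 Real.pi) (hl : l.IsChain (IsArcPair θ))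
    (hlen : 1 < l.length) (hclosed : l.getD 0 0 = l.getD (l.length - 1) 0) :
    IsClosedSphericalCurve (chainLength l) (chain l) where
  pos := by
    rw [chainLength_eq hθ hl]
    have : 0 < l.length - 1 := by omega
    have := hθ.1
    positivity
  mem_sphere α hα := by
    rw [chainLength_eq hθ hl] at hα
    obtain ⟨i, hi, hαi⟩ := exists_mem_Icc_mul hθ.1 (by omega) hα
    rw [chain_eq_geoArc hθ hl (by omega) hαi]
    exact (isArcPair_getD hl (by omega)).norm_geoArc hθ _
  continuousOn := (continuous_chain hθ hl).continuousOn
  piecewise_smooth := by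
    refine ⟨l.length - 1, fun i => i * θ, ?_, by simp, ?_, fun i => ?_⟩
    · intro i j hij
      have := hθ.1
      simp only
      gcongr
      exact_mod_cast hij
    · rw [chainLength_eq hθ hl]
      simp
    · have hi : (i : ℕ) + 1 < l.length := by omega
      have : ContDiffOn ℝ ∞ (fun α => geoArc (l.getD i 0) (l.getD (i + 1) 0) (α - (i : ℕ) * θ))
          (Icc (i.castSucc * θ) (i.succ * θ)) :=
        (contDiff_geoArc.comp (by fun_prop : ContDiff ℝ ∞ fun α : ℝ => α - (i : ℕ) * θ)).contDiffOn
      refine this.congr fun α hα => chain_eq_geoArc hθ hl hi ?_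
      simpa using hα
  closed := by
    have h0 : chain l 0 = l.getD 0 0 := by
      rw [chain_eq_geoArc hθ hl (i := 0) hlen (by simpa using hθ.1.le)]
      simpa using (isArcPair_getD hl (i := 0) hlen).geoArc_zero hθ
    have hsub : l.length - 1 - 1 + 1 = l.length - 1 := by omega
    have h1 : chain l (chainLength l) = l.getD (l.length - 1) 0 := by
      have hcast : ((l.length - 1 : ℕ) : ℝ) = (l.length - 1 - 1 : ℕ) + 1 := by
        exact_mod_cast hsub.symm
      rw [chainLength_eq hθ hl, chain_eq_geoArc hθ hl (i := l.length - 1 - 1) (by omega), hsub,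
        hcast, add_mul, one_mul, add_sub_cancel_left]
      · have := isArcPair_getD hl (i := l.length - 1 - 1) (by omega)
        rw [hsub] at this
        exact this.geoArc_end hθ
      · rw [hcast]
        have := hθ.1
        constructor <;> linarith
    rw [h0, h1, hclosed]

/-- The speed is 1 on the open pieces. The value of `deriv` at the corners does not matter, since
they form a null set. -/
lemma pathIntegral_chain (hθ : θ ∈ Ioo 0 Real.pi) (hl : l.IsChain (IsArcPair θ))
    {f : EuclideanSpace ℝ (Fin n) → ℝ} (hf : Continuous f) :
    pathIntegral (chainLength l) (chain l) f =
      ∑ i ∈ Finset.range (l.length - 1),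
        ∫ s in (0 : ℝ)..θ, f (geoArc (l.getD i 0) (l.getD (i + 1) 0) s) := by
  have hpiece : ∀ i < l.length - 1, ∀ α ∈ Ioo (i * θ) ((i + 1 : ℕ) * θ),
      f (geoArc (l.getD i 0) (l.getD (i + 1) 0) (α - i * θ)) =
        f (chain l α) * ‖deriv (chain l) α‖ := by
    intro i hi α hα
    push_cast at hα
    have hi' : i + 1 < l.length := by omega
    have heq : chain l =ᶠ[nhds α]
        fun α => geoArc (l.getD i 0) (l.getD (i + 1) 0) (α - i * θ) := by
      filter_upwards [Ioo_mem_nhds hα.1 hα.2] with β hβ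
      exact chain_eq_geoArc hθ hl hi' (Ioo_subset_Icc_self hβ)
    rw [heq.deriv_eq, deriv_comp_sub_const, (isArcPair_getD hl hi').norm_deriv_geoArc hθ,
      mul_one, chain_eq_geoArc hθ hl hi' (Ioo_subset_Icc_self hα)]
  have hle : ∀ i : ℕ, i * θ ≤ (i + 1 : ℕ) * θ := fun i => by
    have := hθ.1
    gcongr
    exact i.le_succ
  have hcont : ∀ i : ℕ, Continuous fun α : ℝ =>
      f (geoArc (l.getD i 0) (l.getD (i + 1) 0) (α - i * θ)) := fun i =>
    hf.comp (contDiff_geoArc.continuous.comp (by fun_prop))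
  rw [pathIntegral, chainLength_eq hθ hl]
  have hsum := intervalIntegral.sum_integral_adjacent_intervals (μ := volume)
    (f := fun α => f (chain l α) * ‖deriv (chain l) α‖) (a := fun i : ℕ => i * θ)
    (n := l.length - 1) fun i hi => by
      refine ((hcont i).intervalIntegrable _ _).congr_ae ?_
      rw [uIoc_of_le (hle i), ← restrict_Ioo_eq_restrict_Ioc]
      exact (ae_restrict_iff' measurableSet_Ioo).2 (Filter.Eventually.of_forall (hpiece i hi))
  rw [Nat.cast_zero, zero_mul] at hsum
  rw [← hsum]
  refine Finset.sum_congr rfl fun i hi => ?_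
  rw [← intervalIntegral.integral_congr_Ioo_of_le (hle i) (hpiece i (Finset.mem_range.1 hi)),
    intervalIntegral.integral_comp_sub_right
      (fun s => f (geoArc (l.getD i 0) (l.getD (i + 1) 0) s))]
  congr 1
  · ring
  · push_cast; ring

end Chains

/-! ### Trigonometric polynomials and equally spaced points -/

section Trigonometric

open Complex in
/-- `q` is a trigonometric polynomial of degree at most `t`. -/
def IsTrigPolynomial (t : ℕ) (q : ℝ → ℝ) : Prop :=
  ∃ Q : Polynomial ℂ, Q.natDegree ≤ 2 * t ∧
    ∀ s : ℝ, (q s : ℂ) * exp (s * I) ^ t = Q.eval (exp (s * I))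

namespace IsTrigPolynomial

variable {t u : ℕ} {p q : ℝ → ℝ}

lemma mono (h : IsTrigPolynomial t q) (htu : t ≤ u) : IsTrigPolynomial u q := by
  obtain ⟨Q, hQ, hq⟩ := h
  refine ⟨Q * Polynomial.X ^ (u - t), ?_, fun s => ?_⟩
  · refine Polynomial.natDegree_mul_le.trans ?_
    rw [Polynomial.natDegree_X_pow]
    omega
  · rw [Polynomial.eval_mul, ← hq, Polynomial.eval_pow, Polynomial.eval_X, mul_assoc, ← pow_add,
      Nat.add_sub_cancel' htu]

lemma const (c : ℝ) : IsTrigPolynomial 0 fun _ => c :=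
  ⟨Polynomial.C (c : ℂ), by simp, fun s => by simp⟩

lemma add (hp : IsTrigPolynomial t p) (hq : IsTrigPolynomial t q) :
    IsTrigPolynomial t fun s => p s + q s := by
  obtain ⟨P, hP, hp⟩ := hp
  obtain ⟨Q, hQ, hq⟩ := hq
  refine ⟨P + Q, (Polynomial.natDegree_add_le P Q).trans (max_le hP hQ), fun s => ?_⟩
  rw [Polynomial.eval_add, ← hp, ← hq, ← add_mul, ← Complex.ofReal_add]

lemma mul (hp : IsTrigPolynomial t p) (hq : IsTrigPolynomial u q) :
    IsTrigPolynomial (t + u) fun s => p s * q s := by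
  obtain ⟨P, hP, hp⟩ := hp
  obtain ⟨Q, hQ, hq⟩ := hq
  refine ⟨P * Q, Polynomial.natDegree_mul_le.trans (by omega), fun s => ?_⟩
  rw [Polynomial.eval_mul, ← hp, ← hq, Complex.ofReal_mul]
  ring

lemma pow (hq : IsTrigPolynomial t q) (k : ℕ) : IsTrigPolynomial (k * t) fun s => q s ^ k := by
  induction k with
  | zero => simpa using const 1
  | succ k ih => simpa only [pow_succ, add_mul, one_mul] using ih.mul hq

lemma sum {ι : Type*} (S : Finset ι) {f : ι → ℝ → ℝ} (h : ∀ i ∈ S, IsTrigPolynomial t (f i)) :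
    IsTrigPolynomial t fun s => ∑ i ∈ S, f i s := by
  classical
  induction S using Finset.induction_on with
  | empty => simpa using (const 0).mono t.zero_le
  | insert i S hi ih =>
    simp only [Finset.sum_insert hi]
    exact (h i (Finset.mem_insert_self i S)).add
      (ih fun j hj => h j (Finset.mem_insert_of_mem hj))

lemma prod {ι : Type*} (S : Finset ι) {d : ι → ℕ} {f : ι → ℝ → ℝ}
    (h : ∀ i ∈ S, IsTrigPolynomial (d i) (f i)) :
    IsTrigPolynomial (∑ i ∈ S, d i) fun s => ∏ i ∈ S, f i s := by
  classical
  induction S using Finset.induction_on with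
  | empty => simpa using const 1
  | insert i S hi ih =>
    simp only [Finset.prod_insert hi, Finset.sum_insert hi]
    exact (h i (Finset.mem_insert_self i S)).mul
      (ih fun j hj => h j (Finset.mem_insert_of_mem hj))

open Complex in
lemma cos_add_sin (a b : ℝ) : IsTrigPolynomial 1 fun s => Real.cos s * a + Real.sin s * b := by
  refine ⟨Polynomial.C (((a : ℂ) - b * I) / 2) * Polynomial.X ^ 2 +
    Polynomial.C (((a : ℂ) + b * I) / 2), by compute_degree, fun s => ?_⟩
  have h : exp (s * I) * exp (-(s * I)) = 1 := by rw [← exp_add, add_neg_cancel, exp_zero]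
  simp only [Polynomial.eval_add, Polynomial.eval_mul, Polynomial.eval_C, Polynomial.eval_pow,
    Polynomial.eval_X, pow_one]
  push_cast
  rw [Complex.cos, Complex.sin, neg_mul]
  linear_combination ((a : ℂ) + b * I) / 2 * h

/-- On a great circle every coordinate has the form `a cos s + b sin s`, so a monomial of degree `d`
restricts to a trigonometric polynomial of degree at most `d`. -/
lemma mvPolynomial_eval {n : ℕ} {P : MvPolynomial (Fin n) ℝ} (hP : P.totalDegree ≤ t)
    {γ : ℝ → EuclideanSpace ℝ (Fin n)} {x w : EuclideanSpace ℝ (Fin n)}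
    (hγ : ∀ s, γ s = Real.cos s • x + Real.sin s • w) :
    IsTrigPolynomial t fun s => MvPolynomial.eval (fun i => γ s i) P := by
  simp only [MvPolynomial.eval_eq]
  refine sum _ fun d hd => ?_
  have h1 := (const (P.coeff d)).mul (prod d.support (f := fun i s => γ s i ^ d i)
    (d := fun i => d i * 1) fun i _ => by
      simp only [hγ, PiLp.add_apply, PiLp.smul_apply, smul_eq_mul]
      exact (cos_add_sin (x i) (w i)).pow (d i))
  refine h1.mono ?_
  simp only [zero_add, mul_one]
  exact (MvPolynomial.le_totalDegree hd).trans hP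

open Complex in
/-- The sum of a trigonometric polynomial over the vertices of a regular polygon does not depend
on the position of the polygon, if it has more vertices than the degree. -/
lemma sum_equispaced (hq : IsTrigPolynomial t q) {N : ℕ} (htN : t < N) (s : ℝ) :
    ∑ k ∈ Finset.range N, q (s + k * (2 * Real.pi / N)) =
      ∑ k ∈ Finset.range N, q (k * (2 * Real.pi / N)) := by
  obtain ⟨Q, hQ, hq⟩ := hq
  have hN : (N : ℂ) ≠ 0 := by exact_mod_cast (Nat.zero_lt_of_lt htN).ne'
  -- Fourier expansion: the frequencies `j - t` run from `-t` to `t`.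
  have hexp : ∀ s : ℝ, (q s : ℂ) =
      ∑ j ∈ Finset.range (2 * t + 1), Q.coeff j * exp (((j : ℂ) - t) * (s * I)) := by
    intro s
    have h0 : exp (s * I) ^ t ≠ 0 := pow_ne_zero _ (exp_ne_zero _)
    rw [← mul_left_inj' h0, hq, Polynomial.eval_eq_sum_range' (Nat.lt_succ_of_le hQ),
      Finset.sum_mul]
    refine Finset.sum_congr rfl fun j _ => ?_
    rw [mul_assoc, ← exp_nat_mul, ← exp_nat_mul, ← exp_add]
    congr 2
    ring
  -- Only the constant term `j = t` survives; every other frequency contributes a full geometric sum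
  -- of a nontrivial `N`-th root of unity.
  have key : ∀ s : ℝ, ∑ k ∈ Finset.range N, (q (s + k * (2 * Real.pi / N)) : ℂ) =
      N * Q.coeff t := by
    intro s
    simp only [hexp]
    rw [Finset.sum_comm, Finset.sum_eq_single_of_mem t (by simp; omega)]
    · simp
    · intro j hj hjt
      rw [← Finset.mul_sum]
      refine mul_eq_zero_of_right _ ?_
      set ζ : ℂ := exp (((j : ℂ) - t) * (2 * Real.pi / N * I)) with hζ
      have hterm : ∀ k : ℕ, exp (((j : ℂ) - t) * ((s + k * (2 * Real.pi / N) : ℝ) * I)) =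
          exp (((j : ℂ) - t) * (s * I)) * ζ ^ k := by
        intro k
        rw [hζ, ← exp_nat_mul, ← exp_add]
        congr 1
        push_cast
        ring
      simp only [hterm]
      rw [← Finset.mul_sum]
      refine mul_eq_zero_of_right _ ?_
      have hζN : ζ ^ N = 1 := by
        rw [hζ, ← exp_nat_mul, exp_eq_one_iff]
        refine ⟨(j : ℤ) - t, ?_⟩
        push_cast
        field_simp
      -- Here `0 < |j - t| ≤ t < N`, so `j - t` is not a multiple of `N`.
      have hζ1 : ζ ≠ 1 := by
        intro h
        obtain ⟨z, hz⟩ := exp_eq_one_iff.1 h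
        have h2 : ((j : ℂ) - t) = z * N := by
          have hpi : (2 * Real.pi * I : ℂ) ≠ 0 := two_pi_I_ne_zero
          field_simp at hz
          linear_combination hz
        have h3 : (j : ℤ) - t = z * N := by exact_mod_cast h2
        have hj' := Finset.mem_range.1 hj
        have hz0 : z ≠ 0 := by
          rintro rfl
          apply hjt
          omega
        have h4 : |(j : ℤ) - t| = |z| * N := by rw [h3, abs_mul, Nat.abs_cast]
        have h5 : (1 : ℤ) ≤ |z| := Int.one_le_abs hz0
        have h6 : |(j : ℤ) - t| ≤ t := abs_le.2 ⟨by omega, by omega⟩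
        nlinarith
      have := geom_sum_mul ζ N
      rw [hζN, sub_self] at this
      exact (mul_eq_zero.1 this).resolve_right (sub_ne_zero.2 hζ1)
  have h0 := key 0
  simp only [zero_add] at h0
  exact_mod_cast (key s).trans h0.symm

end IsTrigPolynomial

end Trigonometric

/-! ### Integrals along Euler cycles -/

section EulerCycles

open SimpleGraph

lemma IsEulerCycle.mem_edges {V : Type*} {G : SimpleGraph V} {v : V} {w : G.Walk v v}
    (hw : IsEulerCycle w) {a b : V} (hab : G.Adj a b) : s(a, b) ∈ w.edges := by
  classical
  exact ((Walk.isEulerian_iff w).1 hw).2 _ hab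

/-- The darts of the cycle and their reversals are together all ordered adjacent pairs, each once.
The symmetry of `F` makes both halves contribute equally, so the result is independent of the cycle.
-/
lemma two_mul_sum_eulerian {V : Type*} {G : SimpleGraph V} {v : V} {w : G.Walk v v}
    (hw : IsEulerCycle w) {D : Finset (V × V)} (hD : ∀ p, p ∈ D ↔ G.Adj p.1 p.2)
    {F : V → V → ℝ} (hF : ∀ a b, G.Adj a b → F b a = F a b) :
    2 * ∑ i ∈ Finset.range w.length, F (w.getVert i) (w.getVert (i + 1)) =
      ∑ p ∈ D, F p.1 p.2 := by
  classical
  have hw' := (Walk.isEulerian_iff w).1 hw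
  have hnodup : (w.darts.map Dart.edge).Nodup := hw'.1.edges_nodup
  have hinj := List.inj_on_of_nodup_map hnodup
  set L : List (V × V) := w.darts.map Dart.toProd with hL
  have hLnodup : L.Nodup := by
    refine List.Nodup.map_on (fun d _ d' _ h => Dart.ext _ _ h) (List.Nodup.of_map _ hnodup)
  -- A dart and its reversal in the same walk would use one edge twice, or be equal, which a
  -- loopless graph forbids.
  have hdisj : List.Disjoint L (L.map Prod.swap) := by
    intro p hp hp'
    simp only [hL, List.mem_map] at hp hp'
    obtain ⟨d, hd, rfl⟩ := hp
    obtain ⟨_, ⟨d', hd', rfl⟩, h⟩ := hp'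
    have hsymm : d = d'.symm := Dart.ext _ _ h.symm
    have : d = d' := hinj hd hd' (by rw [hsymm, Dart.edge_symm])
    exact d'.symm_ne (hsymm.symm.trans this)
  have hnd : (L ++ L.map Prod.swap).Nodup :=
    List.nodup_append'.2 ⟨hLnodup, hLnodup.map Prod.swap_injective, hdisj⟩
  have hDL : D = (L ++ L.map Prod.swap).toFinset := by
    ext p
    rw [hD, List.mem_toFinset, List.mem_append]
    constructor
    · intro hp
      have hmem : s(p.1, p.2) ∈ w.darts.map Dart.edge := hw'.2 _ hp
      obtain ⟨d, hd, hde⟩ := List.mem_map.1 hmem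
      rcases Sym2.mk_eq_mk_iff.1 (show s(d.toProd.1, d.toProd.2) = s(p.1, p.2) from hde) with h | h
      · exact Or.inl (List.mem_map.2 ⟨d, hd, h⟩)
      · refine Or.inr (List.mem_map.2 ⟨d.toProd, List.mem_map.2 ⟨d, hd, rfl⟩, ?_⟩)
        rw [h, Prod.swap_swap]
    · rintro (h | h)
      · obtain ⟨d, -, rfl⟩ := List.mem_map.1 h
        exact d.adj
      · obtain ⟨q, hq, rfl⟩ := List.mem_map.1 h
        obtain ⟨d, -, rfl⟩ := List.mem_map.1 hq
        exact d.adj.symm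
  have hsum : (L.map fun p => F p.1 p.2).sum =
      ∑ i ∈ Finset.range w.length, F (w.getVert i) (w.getVert (i + 1)) := by
    clear hDL hnd hdisj hLnodup hinj hnodup hw' hw
    have : ∀ {u v : V} (w : G.Walk u v), (w.darts.map fun d => F d.toProd.1 d.toProd.2).sum =
        ∑ i ∈ Finset.range w.length, F (w.getVert i) (w.getVert (i + 1)) := by
      intro u v w
      induction w with
      | nil => simp
      | cons h w ih =>
        rw [Walk.length_cons, Finset.sum_range_succ', Walk.darts_cons, List.map_cons,
          List.sum_cons, ih, add_comm]
        simp
    rw [hL, List.map_map]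
    exact this w
  have hswap : ((L.map Prod.swap).map fun p => F p.1 p.2).sum =
      (L.map fun p => F p.1 p.2).sum := by
    rw [List.map_map]
    congr 1
    refine List.map_congr_left fun p hp => ?_
    obtain ⟨d, -, rfl⟩ := List.mem_map.1 hp
    exact hF _ _ d.adj
  rw [hDL, List.sum_toFinset _ hnd, List.map_append, List.sum_append, hswap, hsum, two_mul]

variable {n : ℕ} {V : Finset (EuclideanSpace ℝ (Fin n))}

/-- An edge configuration in which every point has the same number `r` of neighbours and every
edge path continues along the great circle; the angle of an edge is `2π/N`. -/
structure IsGeodesicConfiguration (V : Finset (EuclideanSpace ℝ (Fin n))) (N r : ℕ) : Prop extends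
    IsEdgeConfiguration (V : Set (EuclideanSpace ℝ (Fin n))) (Real.cos (2 * Real.pi / N)) where
  two_lt : 2 < N
  nonempty : V.Nonempty
  degree_pos : 0 < r
  continue_mem : ∀ a ∈ V, ∀ b ∈ V, inner ℝ a b = Real.cos (2 * Real.pi / N) →
    (2 * Real.cos (2 * Real.pi / N)) • b - a ∈ V
  degree : ∀ a ∈ V, (V.filter fun b => inner ℝ a b = Real.cos (2 * Real.pi / N)).card = r

namespace IsGeodesicConfiguration

variable {N r : ℕ}

lemma angle_mem (h : IsGeodesicConfiguration V N r) : 2 * Real.pi / N ∈ Ioo 0 Real.pi := by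
  have h2 : (2 : ℝ) < N := by exact_mod_cast h.two_lt
  have := Real.pi_pos
  refine ⟨by positivity, ?_⟩
  rw [div_lt_iff₀ (by linarith)]
  nlinarith

lemma normalize_eq (h : IsGeodesicConfiguration V N r) {v : EuclideanSpace ℝ (Fin n)}
    (hv : v ∈ V) : NormedSpace.normalize v = v := by
  rw [NormedSpace.normalize, h.norm_eq_one v hv, inv_one, one_smul]

/-- The ordered pairs of adjacent points. -/
def darts (V : Finset (EuclideanSpace ℝ (Fin n))) (N : ℕ) :
    Finset (EuclideanSpace ℝ (Fin n) × EuclideanSpace ℝ (Fin n)) :=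
  (V ×ˢ V).filter fun p => inner ℝ p.1 p.2 = Real.cos (2 * Real.pi / N)

lemma mem_darts (h : IsGeodesicConfiguration V N r)
    (p : EuclideanSpace ℝ (Fin n) × EuclideanSpace ℝ (Fin n)) :
    p ∈ darts V N ↔
      (edgeGraph (convexHull ℝ (V : Set (EuclideanSpace ℝ (Fin n))))).Adj p.1 p.2 := by
  rw [h.edgeGraph_adj, darts, Finset.mem_filter, Finset.mem_product, Finset.mem_coe,
    Finset.mem_coe, and_assoc]

lemma isArcPair (h : IsGeodesicConfiguration V N r)
    {p : EuclideanSpace ℝ (Fin n) × EuclideanSpace ℝ (Fin n)} (hp : p ∈ darts V N) :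
    IsArcPair (2 * Real.pi / N) p.1 p.2 := by
  rw [darts, Finset.mem_filter, Finset.mem_product] at hp
  exact ⟨h.norm_eq_one _ hp.1.1, h.norm_eq_one _ hp.1.2, hp.2⟩

lemma sum_darts_fst (h : IsGeodesicConfiguration V N r) (f : EuclideanSpace ℝ (Fin n) → ℝ) :
    ∑ p ∈ darts V N, f p.1 = r * ∑ v ∈ V, f v := by
  rw [darts, Finset.sum_filter, Finset.sum_product, Finset.mul_sum]
  refine Finset.sum_congr rfl fun a ha => ?_
  rw [← Finset.sum_filter]
  refine (Finset.sum_const (f a)).trans ?_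
  rw [h.degree a ha, nsmul_eq_mul]

/-- Going straight on, `(a, b) ↦ (b, 2 cos θ • b - a)` with `θ = 2π/N`, permutes the finite set of
darts: it maps into it and is injective. Advancing all arcs by `θ` therefore only reorders the sum.
-/
lemma sum_geoArc_add (h : IsGeodesicConfiguration V N r) (f : EuclideanSpace ℝ (Fin n) → ℝ)
    (s : ℝ) : ∑ p ∈ darts V N, f (geoArc p.1 p.2 (s + 2 * Real.pi / N)) =
      ∑ p ∈ darts V N, f (geoArc p.1 p.2 s) := by
  classical
  set c := Real.cos (2 * Real.pi / N) with hc
  have hmaps : ∀ p ∈ darts V N, (p.2, (2 * c) • p.2 - p.1) ∈ darts V N := by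
    intro p hp
    have harc := h.isArcPair hp
    rw [darts, Finset.mem_filter, Finset.mem_product] at hp ⊢
    refine ⟨⟨hp.1.2, h.continue_mem _ hp.1.1 _ hp.1.2 hp.2⟩, ?_⟩
    simp only [inner_sub_right, inner_smul_right]
    rw [real_inner_self_eq_norm_sq, harc.2.1, harc.symm.2.2]
    ring
  have hinj : Function.Injective
      fun p : EuclideanSpace ℝ (Fin n) × EuclideanSpace ℝ (Fin n) => (p.2, (2 * c) • p.2 - p.1) := by
    rintro ⟨a, b⟩ ⟨a', b'⟩ hab
    obtain ⟨h1, h2⟩ := Prod.mk.inj hab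
    simp only at h1 h2
    subst h1
    rw [sub_right_inj.1 h2]
  have himg : (darts V N).image (fun p => (p.2, (2 * c) • p.2 - p.1)) = darts V N :=
    Finset.eq_of_subset_of_card_le (Finset.image_subset_iff.2 hmaps)
      (Finset.card_image_of_injective _ hinj).ge
  have hstep : ∀ p ∈ darts V N, f (geoArc p.1 p.2 (s + 2 * Real.pi / N)) =
      f (geoArc p.2 ((2 * c) • p.2 - p.1) s) := by
    intro p hp
    have h' := h.isArcPair (hmaps p hp)
    exact congrArg f ((h.isArcPair hp).geoArc_add h.angle_mem h' s).symm
  rw [Finset.sum_congr rfl hstep]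
  conv_rhs => rw [← himg, Finset.sum_image hinj.injOn]

/-- As a function of `s` the sum is a trigonometric polynomial of degree below `N` with period
`2π/N`, hence constant. Its value at `s = 0` counts every vertex `r` times. -/
lemma sum_geoArc (h : IsGeodesicConfiguration V N r) {P : MvPolynomial (Fin n) ℝ}
    (hP : P.totalDegree < N) (s : ℝ) :
    ∑ p ∈ darts V N, MvPolynomial.eval (fun i => geoArc p.1 p.2 s i) P =
      r * ∑ v ∈ V, MvPolynomial.eval (fun i => v i) P := by
  set g : ℝ → ℝ := fun s => ∑ p ∈ darts V N, MvPolynomial.eval (fun i => geoArc p.1 p.2 s i) P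
    with hg
  have hper : ∀ (k : ℕ) (s : ℝ), g (s + k * (2 * Real.pi / N)) = g s := by
    intro k s
    induction k with
    | zero => simp
    | succ k ih =>
      rw [← ih, Nat.cast_succ, add_mul, one_mul, ← add_assoc]
      exact h.sum_geoArc_add (fun x => MvPolynomial.eval (fun i => x i) P) _
  have htrig : IsTrigPolynomial P.totalDegree g := by
    refine IsTrigPolynomial.sum _ fun p hp => ?_
    obtain ⟨w, -, -, hw⟩ := (h.isArcPair hp).exists_tangent h.angle_mem
    exact IsTrigPolynomial.mvPolynomial_eval le_rfl hw
  have hsum := htrig.sum_equispaced hP s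
  have hper0 : ∀ k : ℕ, g (k * (2 * Real.pi / N)) = g 0 := fun k => by
    simpa using hper k 0
  simp only [hper, hper0, Finset.sum_const, Finset.card_range, nsmul_eq_mul] at hsum
  have hN : (N : ℝ) ≠ 0 := by exact_mod_cast (two_pos.trans h.two_lt).ne'
  change g s = _
  rw [mul_left_cancel₀ hN hsum, ← h.sum_darts_fst fun v => MvPolynomial.eval (fun i => v i) P]
  refine Finset.sum_congr rfl fun p hp => ?_
  rw [(h.isArcPair hp).geoArc_zero h.angle_mem]

variable {v : EuclideanSpace ℝ (Fin n)}
  {w : (edgeGraph (convexHull ℝ (V : Set (EuclideanSpace ℝ (Fin n))))).Walk v v}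

/-- The vertex type of `edgeGraph` is the whole space, so a trivial walk could sit anywhere. As `V`
carries at least one edge, an Euler cycle is nontrivial and each of its points is an endpoint of an
edge. -/
lemma mem_of_mem_support (h : IsGeodesicConfiguration V N r) (hw : IsEulerCycle w)
    {x : EuclideanSpace ℝ (Fin n)} (hx : x ∈ w.support) : x ∈ V := by
  obtain ⟨a, ha⟩ := h.nonempty
  have hb : (V.filter fun b => inner ℝ a b = Real.cos (2 * Real.pi / N)).Nonempty := by
    rw [← Finset.card_pos, h.degree a ha]
    exact h.degree_pos
  obtain ⟨b, hb⟩ := hb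
  rw [Finset.mem_filter] at hb
  have hab := h.edgeGraph_adj.2 ⟨Finset.mem_coe.2 ha, Finset.mem_coe.2 hb.1, hb.2⟩
  have hedge : s(a, b) ∈ w.edges := hw.mem_edges hab
  have hnil : ¬ w.Nil := fun hnil => by
    rw [Walk.edges_eq_nil.2 hnil] at hedge
    simp at hedge
  obtain ⟨e, he, hxe⟩ := (Walk.mem_support_iff_exists_mem_edges_of_not_nil hnil).1 hx
  have hadj := w.edges_subset_edgeSet he
  rw [← Sym2.other_spec hxe, SimpleGraph.mem_edgeSet] at hadj
  exact (h.edgeGraph_adj.1 hadj).1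

end IsGeodesicConfiguration

end EulerCycles

/-! ### Path means along Euler cycles equal vertex means. -/

section EulerCycleIntegrals

open SimpleGraph

namespace IsGeodesicConfiguration

variable {n N r : ℕ} {V : Finset (EuclideanSpace ℝ (Fin n))} {v : EuclideanSpace ℝ (Fin n)}
  {w : (edgeGraph (convexHull ℝ (V : Set (EuclideanSpace ℝ (Fin n))))).Walk v v}

lemma sphericalPoints_eq (h : IsGeodesicConfiguration V N r) (hw : IsEulerCycle w) :
    sphericalPoints w = w.support := by
  rw [sphericalPoints]
  conv_rhs => rw [← List.map_id w.support]
  exact List.map_congr_left fun x hx => h.normalize_eq (h.mem_of_mem_support hw hx)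

lemma isChain_support (h : IsGeodesicConfiguration V N r) :
    w.support.IsChain (IsArcPair (2 * Real.pi / N)) :=
  w.isChain_adj_support.imp fun a b hab => h.isArcPair (p := (a, b)) ((h.mem_darts (a, b)).2 hab)

lemma two_mul_length (h : IsGeodesicConfiguration V N r) (hw : IsEulerCycle w) :
    (2 * w.length : ℝ) = r * V.card := by
  have h1 := two_mul_sum_eulerian hw h.mem_darts (F := fun _ _ => 1) fun _ _ _ => rfl
  have h2 := h.sum_darts_fst fun _ => 1
  simpa using h1.trans h2

lemma length_pos (h : IsGeodesicConfiguration V N r) (hw : IsEulerCycle w) : 0 < w.length := by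
  have h1 := h.two_mul_length hw
  have h2 : (0 : ℝ) < r * V.card := by
    have := h.degree_pos
    have := h.nonempty.card_pos
    positivity
  have h3 : (0 : ℝ) < w.length := by linarith
  exact_mod_cast h3

lemma isClosedSphericalCurve (h : IsGeodesicConfiguration V N r) (hw : IsEulerCycle w) :
    IsClosedSphericalCurve (chainLength (sphericalPoints w)) (chain (sphericalPoints w)) := by
  rw [h.sphericalPoints_eq hw]
  have hpos := h.length_pos hw
  refine isClosedSphericalCurve_chain h.angle_mem h.isChain_support (by simpa using hpos) ?_
  rw [List.getD_eq_getElem _ _ (by simp), List.getD_eq_getElem _ _ (by simp),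
    Walk.support_getElem_eq_getVert, Walk.support_getElem_eq_getVert]
  simp

/-- Integrals over arcs do not depend on orientation, so `two_mul_sum_eulerian` applies; the factor
2 accounts for the two darts of an edge. -/
lemma pathIntegral_eq_sum (h : IsGeodesicConfiguration V N r) (hw : IsEulerCycle w)
    {f : EuclideanSpace ℝ (Fin n) → ℝ} (hf : Continuous f) :
    2 * pathIntegral (chainLength (sphericalPoints w)) (chain (sphericalPoints w)) f =
      ∫ s in (0 : ℝ)..(2 * Real.pi / N), ∑ p ∈ darts V N, f (geoArc p.1 p.2 s) := by
  have hint : ∀ p ∈ darts V N, IntervalIntegrable (fun s => f (geoArc p.1 p.2 s)) volume 0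
      (2 * Real.pi / N) := fun p _ =>
    (hf.comp contDiff_geoArc.continuous).intervalIntegrable _ _
  rw [h.sphericalPoints_eq hw, pathIntegral_chain h.angle_mem h.isChain_support hf,
    intervalIntegral.integral_finsetSum hint,
    ← two_mul_sum_eulerian hw h.mem_darts
      (F := fun a b => ∫ s in (0 : ℝ)..(2 * Real.pi / N), f (geoArc a b s))]
  · congr 1
    rw [Walk.length_support, Nat.add_sub_cancel]
    refine Finset.sum_congr rfl fun i hi => ?_
    have hi' := Finset.mem_range.1 hi
    rw [List.getD_eq_getElem _ _ (by simp; omega), List.getD_eq_getElem _ _ (by simp; omega),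
      Walk.support_getElem_eq_getVert, Walk.support_getElem_eq_getVert]
  · intro a b hab
    have harc := h.isArcPair (p := (a, b)) ((h.mem_darts (a, b)).2 hab)
    simp only [harc.geoArc_symm h.angle_mem]
    rw [intervalIntegral.integral_comp_sub_left fun s => f (geoArc a b s)]
    simp

lemma pathIntegral_eval (h : IsGeodesicConfiguration V N r) (hw : IsEulerCycle w)
    {P : MvPolynomial (Fin n) ℝ} (hP : P.totalDegree < N) :
    2 * pathIntegral (chainLength (sphericalPoints w)) (chain (sphericalPoints w))
      (fun x => MvPolynomial.eval (fun i => x i) P) =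
      2 * Real.pi / N * (r * ∑ v ∈ V, MvPolynomial.eval (fun i => v i) P) := by
  have hcont : Continuous fun x : EuclideanSpace ℝ (Fin n) =>
      MvPolynomial.eval (fun i => x i) P :=
    (MvPolynomial.continuous_eval P).comp (by fun_prop)
  rw [h.pathIntegral_eq_sum hw hcont]
  simp only [h.sum_geoArc hP]
  rw [intervalIntegral.integral_const, smul_eq_mul, sub_zero]

/-- The mean of a polynomial of low degree along the geodesic cycle is the mean over the
points of the configuration. -/
lemma mean_pathIntegral (h : IsGeodesicConfiguration V N r) (hw : IsEulerCycle w)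
    {P : MvPolynomial (Fin n) ℝ} (hP : P.totalDegree < N) (a : ℝ) :
    a / arcLength (chainLength (sphericalPoints w)) (chain (sphericalPoints w)) *
      pathIntegral (chainLength (sphericalPoints w)) (chain (sphericalPoints w))
        (fun x => MvPolynomial.eval (fun i => x i) P) =
      a / V.card * ∑ v ∈ V, MvPolynomial.eval (fun i => v i) P := by
  have h1 := h.pathIntegral_eval hw hP
  -- The constant polynomial gives the arc length with the same factor `2πr/N`, which cancels in the
  -- quotient.
  have h2 := h.pathIntegral_eval hw (P := 1) (by
    rw [MvPolynomial.totalDegree_one]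
    exact two_pos.trans h.two_lt)
  simp only [map_one, Finset.sum_const, nsmul_eq_mul, mul_one] at h2
  have hN : (N : ℝ) ≠ 0 := by exact_mod_cast (two_pos.trans h.two_lt).ne'
  have hr : (r : ℝ) ≠ 0 := by exact_mod_cast h.degree_pos.ne'
  have hV : (V.card : ℝ) ≠ 0 := by exact_mod_cast h.nonempty.card_pos.ne'
  have h1' := eq_div_of_mul_eq two_ne_zero ((mul_comm _ _).trans h1)
  have h2' := eq_div_of_mul_eq two_ne_zero ((mul_comm _ _).trans h2)
  rw [arcLength, h1', h2']
  field_simp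

end IsGeodesicConfiguration

end EulerCycleIntegrals

/-! ### Moments of the unit sphere in three dimensions -/

section SphereMoments

open Measure

lemma integral_pow_mul_exp_neg_sq_Ioi (k : ℕ) :
    ∫ r in Ioi (0 : ℝ), r ^ k * Real.exp (-r ^ 2) = Real.Gamma ((k + 1) / 2) / 2 := by
  have h := integral_rpow_mul_exp_neg_rpow (p := 2) (q := k) two_pos
    (by have := Nat.cast_nonneg (α := ℝ) k; linarith)
  simp only [Real.rpow_natCast, Real.rpow_two] at h
  rw [h]
  ring

lemma integral_pow_two_mul_mul_exp_neg_sq (k : ℕ) :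
    ∫ t : ℝ, t ^ (2 * k) * Real.exp (-t ^ 2) = Real.Gamma (k + 1 / 2) := by
  have h := integral_comp_abs (f := fun t => t ^ (2 * k) * Real.exp (-t ^ 2))
  simp only [sq_abs, (even_two_mul k).pow_abs] at h
  rw [h, integral_pow_mul_exp_neg_sq_Ioi]
  rw [mul_div_cancel₀ _ two_ne_zero]
  congr 1
  push_cast
  ring

lemma integral_pow_odd_mul_exp_neg_sq {k : ℕ} (hk : Odd k) :
    ∫ t : ℝ, t ^ k * Real.exp (-t ^ 2) = 0 := by
  have h := integral_neg_eq_self (fun t : ℝ => t ^ k * Real.exp (-t ^ 2)) volume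
  simp only [hk.neg_pow, neg_sq, neg_mul, integral_neg] at h
  linarith

lemma integral_prod_pow_mul_exp_neg_norm_sq {n : ℕ} (d : Fin n → ℕ) :
    ∫ x : EuclideanSpace ℝ (Fin n), (∏ i, x i ^ d i) * Real.exp (-‖x‖ ^ 2) =
      ∏ i, ∫ t : ℝ, t ^ d i * Real.exp (-t ^ 2) := by
  rw [← integral_fintype_prod_volume_eq_prod (f := fun i (t : ℝ) => t ^ d i * Real.exp (-t ^ 2)),
    ← (PiLp.volume_preserving_toLp (Fin n)).integral_comp
      (MeasurableEquiv.toLp 2 (Fin n → ℝ)).measurableEmbedding]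
  congr 1
  ext x
  rw [Finset.prod_mul_distrib, ← Real.exp_sum, EuclideanSpace.real_norm_sq_eq,
    Finset.sum_neg_distrib]

/-- Polar coordinates for a monomial against the Gaussian weight. -/
lemma integral_sphere_mul_integral_Ioi {n : ℕ} (d : Fin (n + 1) → ℕ) :
    (∫ x : Metric.sphere (0 : EuclideanSpace ℝ (Fin (n + 1))) 1, ∏ i, x.1 i ^ d i
        ∂(volume : Measure (EuclideanSpace ℝ (Fin (n + 1)))).toSphere) *
      ∫ r in Ioi (0 : ℝ), r ^ (n + ∑ i, d i) * Real.exp (-r ^ 2) =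
    ∏ i, ∫ t : ℝ, t ^ d i * Real.exp (-t ^ 2) := by
  set E := EuclideanSpace ℝ (Fin (n + 1)) with hE
  set f : E → ℝ := fun x => (∏ i, x i ^ d i) * Real.exp (-‖x‖ ^ 2) with hf
  have hdim : Module.finrank ℝ E - 1 = n := by
    have h : Module.finrank ℝ E = n + 1 := finrank_euclideanSpace_fin
    omega
  have hpolar : ∀ x : ({(0)}ᶜ : Set E), f x =
      (∏ i, (homeomorphUnitSphereProd E x).1.1 i ^ d i) *
        ((homeomorphUnitSphereProd E x).2.1 ^ (∑ i, d i) *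
          Real.exp (-(homeomorphUnitSphereProd E x).2.1 ^ 2)) := by
    intro x
    have hx : ‖x.1‖ ≠ 0 := norm_ne_zero_iff.2 x.2
    simp only [homeomorphUnitSphereProd_apply_snd_coe, homeomorphUnitSphereProd_apply_fst_coe, hf]
    rw [← mul_assoc]
    congr 1
    rw [← Finset.prod_pow_eq_pow_sum, ← Finset.prod_mul_distrib]
    refine Finset.prod_congr rfl fun i _ => ?_
    rw [← mul_pow, PiLp.smul_apply, smul_eq_mul]
    field_simp
  calc _ = ∫ x, (∏ i, x.1.1 i ^ d i) * (x.2.1 ^ (∑ i, d i) * Real.exp (-x.2.1 ^ 2))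
        ∂(volume : Measure E).toSphere.prod (volumeIoiPow (Module.finrank ℝ E - 1)) := by
        rw [integral_prod_mul (fun x : Metric.sphere (0 : E) 1 => ∏ i, x.1 i ^ d i)
          (fun r : Ioi (0 : ℝ) => r.1 ^ (∑ i, d i) * Real.exp (-r.1 ^ 2))]
        congr 1
        rw [hdim]
        simp only [volumeIoiPow, ENNReal.ofReal]
        rw [integral_withDensity_eq_integral_smul,
          integral_subtype_comap measurableSet_Ioi fun r : ℝ =>
            Real.toNNReal (r ^ n) • (r ^ (∑ i, d i) * Real.exp (-r ^ 2))]
        · refine setIntegral_congr_fun measurableSet_Ioi fun r hr => ?_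
          simp only [NNReal.smul_def]
          rw [Real.coe_toNNReal _ (pow_nonneg (mem_Ioi.1 hr).le _), smul_eq_mul, pow_add,
            mul_assoc]
        · exact (measurable_subtype_coe.pow_const _).real_toNNReal
    _ = ∫ x : ({(0)}ᶜ : Set E), f x ∂((volume : Measure E).comap (↑)) := by
        rw [← (volume : Measure E).measurePreserving_homeomorphUnitSphereProd.integral_comp
          (Homeomorph.measurableEmbedding _)]
        simp only [hpolar]
    _ = ∫ x, f x := by
        rw [integral_subtype_comap (measurableSet_singleton _).compl f, restrict_compl_singleton]
    _ = _ := integral_prod_pow_mul_exp_neg_norm_sq d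

open scoped Nat

lemma integral_sphere_odd {d : Fin 3 → ℕ} {i : Fin 3} (hi : Odd (d i)) :
    ∫ x : Metric.sphere (0 : EuclideanSpace ℝ (Fin 3)) 1, ∏ i, x.1 i ^ d i
        ∂(volume : Measure (EuclideanSpace ℝ (Fin 3))).toSphere = 0 := by
  have h := integral_sphere_mul_integral_Ioi d
  rw [Finset.prod_eq_zero (Finset.mem_univ i) (integral_pow_odd_mul_exp_neg_sq hi),
    integral_pow_mul_exp_neg_sq_Ioi] at h
  refine (mul_eq_zero.1 h).resolve_right (div_ne_zero (Real.Gamma_pos_of_pos ?_).ne' two_ne_zero)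
  positivity

/-- Dividing the Gaussian integrals `Γ(e i + 1/2)` by the radial integral `Γ(∑ e + 3/2) / 2` gives
the double factorials. For `e i = 0` truncated subtraction yields `0‼ = 1`, the conventional value
of `(-1)‼`. -/
lemma integral_sphere_even (e : Fin 3 → ℕ) :
    ∫ x : Metric.sphere (0 : EuclideanSpace ℝ (Fin 3)) 1, ∏ i, x.1 i ^ (2 * e i)
        ∂(volume : Measure (EuclideanSpace ℝ (Fin 3))).toSphere =
      4 * Real.pi * ((∏ i, (2 * e i - 1)‼ : ℕ) / (2 * (∑ i, e i) + 1)‼) := by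
  have h := integral_sphere_mul_integral_Ioi fun i => 2 * e i
  have hG : ((2 + ∑ i, 2 * e i : ℕ) + 1 : ℝ) / 2 = (∑ i, e i + 1 : ℕ) + 1 / 2 := by
    rw [← Finset.mul_sum]
    push_cast
    ring
  simp only [integral_pow_two_mul_mul_exp_neg_sq] at h
  rw [integral_pow_mul_exp_neg_sq_Ioi, hG] at h
  simp only [Real.Gamma_nat_add_half] at h
  rw [Finset.prod_div_distrib, Finset.prod_mul_distrib, Finset.prod_const, Finset.card_univ,
    Fintype.card_fin, Finset.prod_pow_eq_pow_sum, show 2 * (∑ i, e i + 1) - 1 =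
      2 * (∑ i, e i) + 1 by omega, pow_succ (2 : ℝ) (∑ i, e i)] at h
  have hpi : √Real.pi ^ 2 = Real.pi := Real.sq_sqrt Real.pi_pos.le
  have hpi0 : √Real.pi ≠ 0 := (Real.sqrt_pos.2 Real.pi_pos).ne'
  have hdf : ((2 * (∑ i, e i) + 1)‼ : ℝ) ≠ 0 := by
    exact_mod_cast (Nat.doubleFactorial_pos _).ne'
  push_cast
  field_simp at h ⊢
  refine mul_right_cancel₀ hpi0 (h.trans ?_)
  linear_combination 4 * (∏ i, ((2 * e i - 1)‼ : ℝ)) * √Real.pi * hpi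

lemma integrable_sphere {f : EuclideanSpace ℝ (Fin 3) → ℝ} (hf : Continuous f) :
    Integrable (fun x : Metric.sphere (0 : EuclideanSpace ℝ (Fin 3)) 1 => f x)
      (volume : Measure (EuclideanSpace ℝ (Fin 3))).toSphere :=
  (hf.comp continuous_subtype_val).integrable_of_hasCompactSupport
    (HasCompactSupport.of_compactSpace _)

lemma sphereIntegral_eq (f : EuclideanSpace ℝ (Fin 3) → ℝ) :
    sphereIntegral f = (4 * Real.pi)⁻¹ *
      ∫ x : Metric.sphere (0 : EuclideanSpace ℝ (Fin 3)) 1, f x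
        ∂(volume : Measure (EuclideanSpace ℝ (Fin 3))).toSphere := by
  -- The zero exponent gives the total surface measure `4π`.
  have h := integral_sphere_even 0
  simp only [Pi.zero_apply, mul_zero, pow_zero, Finset.prod_const_one, integral_const,
    smul_eq_mul, mul_one] at h
  rw [sphereIntegral, average_eq, h]
  simp

lemma sphereIntegral_odd {d : Fin 3 → ℕ} {i : Fin 3} (hi : Odd (d i)) :
    sphereIntegral (fun x => ∏ i, x i ^ d i) = 0 := by
  rw [sphereIntegral_eq, integral_sphere_odd hi, mul_zero]

lemma sphereIntegral_even (e : Fin 3 → ℕ) :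
    sphereIntegral (fun x => ∏ i, x i ^ (2 * e i)) =
      (∏ i, (2 * e i - 1)‼ : ℕ) / (2 * (∑ i, e i) + 1)‼ := by
  rw [sphereIntegral_eq, integral_sphere_even, inv_mul_cancel_left₀]
  have := Real.pi_pos
  positivity

/-- The sphere integral of a polynomial as a combination of sphere integrals of monomials. -/
lemma sphereIntegral_eval (P : MvPolynomial (Fin 3) ℝ) :
    sphereIntegral (fun x => MvPolynomial.eval (fun i => x i) P) =
      ∑ d ∈ P.support, P.coeff d * sphereIntegral (fun x => ∏ i, x i ^ d i) := by
  simp only [sphereIntegral_eq, MvPolynomial.eval_eq']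
  rw [integral_finsetSum _ fun d _ => integrable_sphere (f := fun x => P.coeff d * ∏ i, x i ^ d i)
    (by fun_prop), Finset.mul_sum]
  refine Finset.sum_congr rfl fun d _ => ?_
  rw [integral_const_mul]
  ring

end SphereMoments

/-! ### Exact arithmetic with points over `ℤ[φ]` -/

/-- The number `re + im * φ`. -/
structure GoldenInt where
  re : ℤ
  im : ℤ
deriving DecidableEq

namespace GoldenInt

instance : Zero GoldenInt := ⟨⟨0, 0⟩⟩
instance : One GoldenInt := ⟨⟨1, 0⟩⟩
instance : Neg GoldenInt := ⟨fun x => ⟨-x.re, -x.im⟩⟩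
instance : Add GoldenInt := ⟨fun x y => ⟨x.re + y.re, x.im + y.im⟩⟩
instance : Sub GoldenInt := ⟨fun x y => ⟨x.re - y.re, x.im - y.im⟩⟩
instance : Mul GoldenInt :=
  ⟨fun x y => ⟨x.re * y.re + x.im * y.im, x.re * y.im + x.im * (y.re + y.im)⟩⟩

/-- Multiplication by `φ`. -/
def mulPhi (x : GoldenInt) : GoldenInt := ⟨x.im, x.re + x.im⟩

def power (x : GoldenInt) : ℕ → GoldenInt
  | 0 => 1
  | n + 1 => power x n * x

/-- A criterion for positivity, from `3 / 2 < φ < 5 / 3`. -/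
def positive (x : GoldenInt) : Bool := 0 < 2 * x.re + 3 * x.im && 0 < 3 * x.re + 5 * x.im

end GoldenInt

structure GoldenPoint where
  x : GoldenInt
  y : GoldenInt
  z : GoldenInt
deriving DecidableEq

namespace GoldenPoint

instance : Add GoldenPoint := ⟨fun u v => ⟨u.x + v.x, u.y + v.y, u.z + v.z⟩⟩
instance : Sub GoldenPoint := ⟨fun u v => ⟨u.x - v.x, u.y - v.y, u.z - v.z⟩⟩

def mulPhi (u : GoldenPoint) : GoldenPoint := ⟨u.x.mulPhi, u.y.mulPhi, u.z.mulPhi⟩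

def scale (c : GoldenInt) (u : GoldenPoint) : GoldenPoint := ⟨c * u.x, c * u.y, c * u.z⟩

def dot (u v : GoldenPoint) : GoldenInt := u.x * v.x + u.y * v.y + u.z * v.z

def flip (i j k : ℤ) (u : GoldenPoint) : GoldenPoint :=
  ⟨⟨i * u.x.re, i * u.x.im⟩, ⟨j * u.y.re, j * u.y.im⟩, ⟨k * u.z.re, k * u.z.im⟩⟩

/-- There is a neighbour `c` of `a` such that the segment from `a` to `b` meets, or lies below, a
segment from `c` to a further point. -/
def crosses (L : List GoldenPoint) (κ : GoldenInt) (a b : GoldenPoint) : Bool :=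
  let N := L.filter fun c => dot a c = κ
  N.any (fun c => mulPhi (a + b - c) ∈ L) || N.any (fun c => b + mulPhi (a - c) ∈ L) ||
    N.any (fun c => a + b + c - mulPhi c ∈ L) || N.any (fun c => a + b - c ∈ L)

/-- The sum over `L` of the monomial with exponents `2a`, `2b`, `2c`. -/
def moment (a b c : ℕ) : List GoldenPoint → GoldenInt
  | [] => 0
  | u :: L => u.x.power (2 * a) * u.y.power (2 * b) * u.z.power (2 * c) + moment a b c L

def octahedronPoints : List GoldenPoint := [
  ⟨⟨2, 0⟩, ⟨0, 0⟩, ⟨0, 0⟩⟩, ⟨⟨-2, 0⟩, ⟨0, 0⟩, ⟨0, 0⟩⟩,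
  ⟨⟨0, 0⟩, ⟨2, 0⟩, ⟨0, 0⟩⟩, ⟨⟨0, 0⟩, ⟨-2, 0⟩, ⟨0, 0⟩⟩,
  ⟨⟨0, 0⟩, ⟨0, 0⟩, ⟨2, 0⟩⟩, ⟨⟨0, 0⟩, ⟨0, 0⟩, ⟨-2, 0⟩⟩]

def cuboctahedronPoints : List GoldenPoint := [
  ⟨⟨1, 0⟩, ⟨1, 0⟩, ⟨0, 0⟩⟩, ⟨⟨1, 0⟩, ⟨-1, 0⟩, ⟨0, 0⟩⟩,
  ⟨⟨-1, 0⟩, ⟨1, 0⟩, ⟨0, 0⟩⟩, ⟨⟨-1, 0⟩, ⟨-1, 0⟩, ⟨0, 0⟩⟩,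
  ⟨⟨0, 0⟩, ⟨1, 0⟩, ⟨1, 0⟩⟩, ⟨⟨0, 0⟩, ⟨1, 0⟩, ⟨-1, 0⟩⟩,
  ⟨⟨0, 0⟩, ⟨-1, 0⟩, ⟨1, 0⟩⟩, ⟨⟨0, 0⟩, ⟨-1, 0⟩, ⟨-1, 0⟩⟩,
  ⟨⟨1, 0⟩, ⟨0, 0⟩, ⟨1, 0⟩⟩, ⟨⟨1, 0⟩, ⟨0, 0⟩, ⟨-1, 0⟩⟩,
  ⟨⟨-1, 0⟩, ⟨0, 0⟩, ⟨1, 0⟩⟩, ⟨⟨-1, 0⟩, ⟨0, 0⟩, ⟨-1, 0⟩⟩]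

def cubePoints : List GoldenPoint := [
  ⟨⟨1, 0⟩, ⟨1, 0⟩, ⟨1, 0⟩⟩, ⟨⟨1, 0⟩, ⟨1, 0⟩, ⟨-1, 0⟩⟩,
  ⟨⟨1, 0⟩, ⟨-1, 0⟩, ⟨1, 0⟩⟩, ⟨⟨1, 0⟩, ⟨-1, 0⟩, ⟨-1, 0⟩⟩,
  ⟨⟨-1, 0⟩, ⟨1, 0⟩, ⟨1, 0⟩⟩, ⟨⟨-1, 0⟩, ⟨1, 0⟩, ⟨-1, 0⟩⟩,
  ⟨⟨-1, 0⟩, ⟨-1, 0⟩, ⟨1, 0⟩⟩, ⟨⟨-1, 0⟩, ⟨-1, 0⟩, ⟨-1, 0⟩⟩]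

def icosahedronPoints : List GoldenPoint := [
  ⟨⟨0, 1⟩, ⟨1, 0⟩, ⟨0, 0⟩⟩, ⟨⟨0, 1⟩, ⟨-1, 0⟩, ⟨0, 0⟩⟩,
  ⟨⟨0, -1⟩, ⟨1, 0⟩, ⟨0, 0⟩⟩, ⟨⟨0, -1⟩, ⟨-1, 0⟩, ⟨0, 0⟩⟩,
  ⟨⟨0, 0⟩, ⟨0, 1⟩, ⟨1, 0⟩⟩, ⟨⟨0, 0⟩, ⟨0, 1⟩, ⟨-1, 0⟩⟩,
  ⟨⟨0, 0⟩, ⟨0, -1⟩, ⟨1, 0⟩⟩, ⟨⟨0, 0⟩, ⟨0, -1⟩, ⟨-1, 0⟩⟩,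
  ⟨⟨1, 0⟩, ⟨0, 0⟩, ⟨0, 1⟩⟩, ⟨⟨1, 0⟩, ⟨0, 0⟩, ⟨0, -1⟩⟩,
  ⟨⟨-1, 0⟩, ⟨0, 0⟩, ⟨0, 1⟩⟩, ⟨⟨-1, 0⟩, ⟨0, 0⟩, ⟨0, -1⟩⟩]

def icosidodecahedronPoints : List GoldenPoint := [
  ⟨⟨2, 0⟩, ⟨0, 0⟩, ⟨0, 0⟩⟩, ⟨⟨-2, 0⟩, ⟨0, 0⟩, ⟨0, 0⟩⟩,
  ⟨⟨0, 0⟩, ⟨2, 0⟩, ⟨0, 0⟩⟩, ⟨⟨0, 0⟩, ⟨-2, 0⟩, ⟨0, 0⟩⟩,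
  ⟨⟨0, 0⟩, ⟨0, 0⟩, ⟨2, 0⟩⟩, ⟨⟨0, 0⟩, ⟨0, 0⟩, ⟨-2, 0⟩⟩,
  ⟨⟨0, 1⟩, ⟨-1, 1⟩, ⟨1, 0⟩⟩, ⟨⟨0, 1⟩, ⟨-1, 1⟩, ⟨-1, 0⟩⟩,
  ⟨⟨0, 1⟩, ⟨1, -1⟩, ⟨1, 0⟩⟩, ⟨⟨0, 1⟩, ⟨1, -1⟩, ⟨-1, 0⟩⟩,
  ⟨⟨0, -1⟩, ⟨-1, 1⟩, ⟨1, 0⟩⟩, ⟨⟨0, -1⟩, ⟨-1, 1⟩, ⟨-1, 0⟩⟩,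
  ⟨⟨0, -1⟩, ⟨1, -1⟩, ⟨1, 0⟩⟩, ⟨⟨0, -1⟩, ⟨1, -1⟩, ⟨-1, 0⟩⟩,
  ⟨⟨1, 0⟩, ⟨0, 1⟩, ⟨-1, 1⟩⟩, ⟨⟨1, 0⟩, ⟨0, 1⟩, ⟨1, -1⟩⟩,
  ⟨⟨1, 0⟩, ⟨0, -1⟩, ⟨-1, 1⟩⟩, ⟨⟨1, 0⟩, ⟨0, -1⟩, ⟨1, -1⟩⟩,
  ⟨⟨-1, 0⟩, ⟨0, 1⟩, ⟨-1, 1⟩⟩, ⟨⟨-1, 0⟩, ⟨0, 1⟩, ⟨1, -1⟩⟩,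
  ⟨⟨-1, 0⟩, ⟨0, -1⟩, ⟨-1, 1⟩⟩, ⟨⟨-1, 0⟩, ⟨0, -1⟩, ⟨1, -1⟩⟩,
  ⟨⟨-1, 1⟩, ⟨1, 0⟩, ⟨0, 1⟩⟩, ⟨⟨-1, 1⟩, ⟨1, 0⟩, ⟨0, -1⟩⟩,
  ⟨⟨-1, 1⟩, ⟨-1, 0⟩, ⟨0, 1⟩⟩, ⟨⟨-1, 1⟩, ⟨-1, 0⟩, ⟨0, -1⟩⟩,
  ⟨⟨1, -1⟩, ⟨1, 0⟩, ⟨0, 1⟩⟩, ⟨⟨1, -1⟩, ⟨1, 0⟩, ⟨0, -1⟩⟩,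
  ⟨⟨1, -1⟩, ⟨-1, 0⟩, ⟨0, 1⟩⟩, ⟨⟨1, -1⟩, ⟨-1, 0⟩, ⟨0, -1⟩⟩]

def dodecahedronPoints : List GoldenPoint := [
  ⟨⟨1, 0⟩, ⟨1, 0⟩, ⟨1, 0⟩⟩, ⟨⟨1, 0⟩, ⟨1, 0⟩, ⟨-1, 0⟩⟩,
  ⟨⟨1, 0⟩, ⟨-1, 0⟩, ⟨1, 0⟩⟩, ⟨⟨1, 0⟩, ⟨-1, 0⟩, ⟨-1, 0⟩⟩,
  ⟨⟨-1, 0⟩, ⟨1, 0⟩, ⟨1, 0⟩⟩, ⟨⟨-1, 0⟩, ⟨1, 0⟩, ⟨-1, 0⟩⟩,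
  ⟨⟨-1, 0⟩, ⟨-1, 0⟩, ⟨1, 0⟩⟩, ⟨⟨-1, 0⟩, ⟨-1, 0⟩, ⟨-1, 0⟩⟩,
  ⟨⟨0, 1⟩, ⟨0, 0⟩, ⟨-1, 1⟩⟩, ⟨⟨0, 1⟩, ⟨0, 0⟩, ⟨1, -1⟩⟩,
  ⟨⟨0, -1⟩, ⟨0, 0⟩, ⟨-1, 1⟩⟩, ⟨⟨0, -1⟩, ⟨0, 0⟩, ⟨1, -1⟩⟩,
  ⟨⟨-1, 1⟩, ⟨0, 1⟩, ⟨0, 0⟩⟩, ⟨⟨-1, 1⟩, ⟨0, -1⟩, ⟨0, 0⟩⟩,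
  ⟨⟨1, -1⟩, ⟨0, 1⟩, ⟨0, 0⟩⟩, ⟨⟨1, -1⟩, ⟨0, -1⟩, ⟨0, 0⟩⟩,
  ⟨⟨0, 0⟩, ⟨-1, 1⟩, ⟨0, 1⟩⟩, ⟨⟨0, 0⟩, ⟨-1, 1⟩, ⟨0, -1⟩⟩,
  ⟨⟨0, 0⟩, ⟨1, -1⟩, ⟨0, 1⟩⟩, ⟨⟨0, 0⟩, ⟨1, -1⟩, ⟨0, -1⟩⟩]

/-- The indices of the successive vertices of an Euler cycle. -/
def cuboctahedronCircuit : List ℕ := [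
  0, 9, 7, 11, 3, 10, 6, 8, 4, 10, 2, 11, 5, 9, 1, 7, 3, 6, 1, 8, 0, 5,
  2, 4, 0]

/-- The indices of the successive vertices of an Euler cycle. -/
def icosidodecahedronCircuit : List ℕ := [
  0, 9, 25, 29, 21, 20, 28, 12, 20, 3, 21, 13, 29, 5, 27, 23, 15, 14, 22, 26, 18, 19,
  27, 11, 19, 2, 18, 10, 12, 1, 13, 11, 1, 10, 26, 4, 28, 24, 16, 17, 25, 5, 23, 7,
  15, 2, 14, 6, 22, 4, 24, 8, 16, 3, 17, 9, 7, 0, 8, 6, 0]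

end GoldenPoint

open GoldenPoint

/-- The computable conditions for the points of `L` to form a geodesic configuration. -/
structure GeodesicModel (L R : List GoldenPoint) (n : ℤ) (κ γ : GoldenInt) (r : ℕ) : Prop where
  nodup : L.Nodup
  ne_nil : L ≠ []
  dot_self : ∀ u ∈ L, dot u u = ⟨n, 0⟩
  trichotomy : ∀ u ∈ L, ∀ v ∈ L, u = v ∨ dot u v = κ ∨ (κ - dot u v).positive
  flip_mem : ∀ u ∈ L, ∀ i ∈ [(1 : ℤ), -1], ∀ j ∈ [(1 : ℤ), -1], ∀ k ∈ [(1 : ℤ), -1],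
    flip i j k u ∈ L
  exists_flip : ∀ u ∈ L, ∃ i ∈ [(1 : ℤ), -1], ∃ j ∈ [(1 : ℤ), -1], ∃ k ∈ [(1 : ℤ), -1],
    flip i j k u ∈ R
  subset : ∀ u ∈ R, u ∈ L
  crosses : ∀ a ∈ R, ∀ b ∈ L, a = b ∨ dot a b = κ ∨ crosses L κ a b
  continue_mem : ∀ u ∈ L, ∀ v ∈ L, dot u v = κ → scale γ v - u ∈ L
  degree : ∀ u ∈ L, (L.filter fun v => dot u v = κ).length = r

/-- Unlike in `GeodesicModel`, the norms may differ, as for the rhombic polytopes. `one_lt` serves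
to exclude the origin. -/
structure ExposedModel (L : List GoldenPoint) : Prop where
  nodup : L.Nodup
  one_lt : 1 < L.length
  exposed : ∀ u ∈ L, ∀ v ∈ L, u = v ∨ (dot u u - dot u v).positive
  flip_mem : ∀ u ∈ L, ∀ i ∈ [(1 : ℤ), -1], ∀ j ∈ [(1 : ℤ), -1], ∀ k ∈ [(1 : ℤ), -1],
    flip i j k u ∈ L

/-- The successive points of an Euler cycle. -/
structure CircuitModel (L C : List GoldenPoint) (κ : GoldenInt) : Prop where
  ne_nil : C ≠ []
  closed : C.head? = C.getLast?
  adj : ∀ p ∈ C.zip C.tail, p.1 ∈ L ∧ p.2 ∈ L ∧ dot p.1 p.2 = κ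
  pairwise : (C.zip C.tail).Pairwise fun p q => p ≠ q ∧ p ≠ q.swap
  covers : ∀ u ∈ L, ∀ v ∈ L, dot u v = κ → (u, v) ∈ C.zip C.tail ∨ (v, u) ∈ C.zip C.tail

open scoped Nat in
/-- The moment identities, with denominators cleared, for the weight `W₁ / W` at the normalized
points of `L₁` and `L₂` and the weight `W₂ / W` at the normalized points of `L₃`. -/
def CubatureModel (L₁ L₂ L₃ : List GoldenPoint) (μ₁ μ₂ μ₃ : GoldenInt) (Q W₁ W₂ W : ℤ)
    (K : ℕ) : Prop :=
  ∀ a ∈ List.range (K + 1), ∀ b ∈ List.range (K + 1), ∀ c ∈ List.range (K + 1), a + b + c ≤ K →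
    ⟨(2 * (a + b + c) + 1)‼, 0⟩ *
      (⟨W₁, 0⟩ * (μ₁.power (a + b + c) * moment a b c L₁ + μ₂.power (a + b + c) * moment a b c L₂) +
        ⟨W₂, 0⟩ * (μ₃.power (a + b + c) * moment a b c L₃)) =
    (⟨W * Q ^ (a + b + c) * ((2 * a - 1)‼ * (2 * b - 1)‼ * (2 * c - 1)‼ : ℕ), 0⟩ : GoldenInt)

/-! ### From exact arithmetic to points of space -/

namespace GoldenInt

def toReal (x : GoldenInt) : ℝ := x.re + x.im * φ

lemma toReal_zero : toReal 0 = 0 := by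
  change ((0 : ℤ) : ℝ) + (0 : ℤ) * φ = 0
  simp

lemma toReal_one : toReal 1 = 1 := by
  change ((1 : ℤ) : ℝ) + (0 : ℤ) * φ = 1
  simp

lemma toReal_int (n : ℤ) : toReal ⟨n, 0⟩ = n := by simp [toReal]

lemma toReal_neg (x : GoldenInt) : toReal (-x) = -toReal x := by
  change ((-x.re : ℤ) : ℝ) + (-x.im : ℤ) * φ = -(x.re + x.im * φ)
  push_cast
  ring

lemma toReal_add (x y : GoldenInt) : toReal (x + y) = toReal x + toReal y := by
  change ((x.re + y.re : ℤ) : ℝ) + (x.im + y.im : ℤ) * φ = x.re + x.im * φ + (y.re + y.im * φ)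
  push_cast
  ring

lemma toReal_sub (x y : GoldenInt) : toReal (x - y) = toReal x - toReal y := by
  change ((x.re - y.re : ℤ) : ℝ) + (x.im - y.im : ℤ) * φ = x.re + x.im * φ - (y.re + y.im * φ)
  push_cast
  ring

lemma toReal_mul (x y : GoldenInt) : toReal (x * y) = toReal x * toReal y := by
  change ((x.re * y.re + x.im * y.im : ℤ) : ℝ) + (x.re * y.im + x.im * (y.re + y.im) : ℤ) * φ =
    (x.re + x.im * φ) * (y.re + y.im * φ)
  push_cast
  linear_combination -(x.im * y.im : ℝ) * Real.goldenRatio_sq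

lemma toReal_mulPhi (x : GoldenInt) : toReal (mulPhi x) = φ * toReal x := by
  rw [toReal, toReal, mulPhi]
  push_cast
  linear_combination -(x.im : ℝ) * Real.goldenRatio_sq

lemma toReal_power (x : GoldenInt) (n : ℕ) : toReal (power x n) = toReal x ^ n := by
  induction n with
  | zero => exact toReal_one.trans (pow_zero _).symm
  | succ n ih => rw [power, toReal_mul, ih, pow_succ]

lemma toReal_pos {x : GoldenInt} (hx : x.positive) : 0 < toReal x := by
  simp only [positive, Bool.and_eq_true, decide_eq_true_eq] at hx
  have h1 : (0 : ℝ) < 2 * x.re + 3 * x.im := by exact_mod_cast hx.1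
  have h2 : (0 : ℝ) < 3 * x.re + 5 * x.im := by exact_mod_cast hx.2
  have hsq := Real.goldenRatio_sq
  have hpos := Real.goldenRatio_pos
  have h3 : 3 / 2 < φ := by nlinarith
  have h4 : φ < 5 / 3 := by nlinarith
  rw [toReal]
  rcases le_total 0 (x.im : ℝ) with h | h <;> nlinarith

end GoldenInt

namespace GoldenPoint

open GoldenInt

def toSpace (u : GoldenPoint) : EuclideanSpace ℝ (Fin 3) := !₂[toReal u.x, toReal u.y, toReal u.z]

lemma toSpace_add (u v : GoldenPoint) : toSpace (u + v) = toSpace u + toSpace v := by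
  ext i
  fin_cases i
  exacts [toReal_add _ _, toReal_add _ _, toReal_add _ _]

lemma toSpace_sub (u v : GoldenPoint) : toSpace (u - v) = toSpace u - toSpace v := by
  ext i
  fin_cases i
  exacts [toReal_sub _ _, toReal_sub _ _, toReal_sub _ _]

lemma toSpace_mulPhi (u : GoldenPoint) : toSpace (mulPhi u) = φ • toSpace u := by
  ext i
  fin_cases i
  exacts [toReal_mulPhi _, toReal_mulPhi _, toReal_mulPhi _]

lemma toSpace_scale (c : GoldenInt) (u : GoldenPoint) :
    toSpace (scale c u) = toReal c • toSpace u := by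
  ext i
  fin_cases i
  exacts [toReal_mul _ _, toReal_mul _ _, toReal_mul _ _]

lemma inner_toSpace (u v : GoldenPoint) :
    inner ℝ (toSpace u) (toSpace v) = toReal (dot u v) := by
  simp only [dot, toReal_add, toReal_mul, toSpace, PiLp.inner_apply, Fin.sum_univ_three,
    RCLike.inner_apply, conj_trivial]
  simp
  ring

/-- The linear map that multiplies the coordinates by the given numbers. -/
def diagonalMap (i j k : ℝ) : EuclideanSpace ℝ (Fin 3) →ₗ[ℝ] EuclideanSpace ℝ (Fin 3) where
  toFun x := !₂[i * x 0, j * x 1, k * x 2]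
  map_add' x y := by
    ext l
    fin_cases l <;> simp [mul_add]
  map_smul' a x := by
    ext l
    fin_cases l <;> simp [mul_left_comm]

lemma toSpace_flip (i j k : ℤ) (u : GoldenPoint) :
    toSpace (flip i j k u) = diagonalMap i j k (toSpace u) := by
  ext l
  fin_cases l <;> simp [toSpace, flip, diagonalMap, toReal, mul_add, mul_assoc]

lemma sq_eq_one_of_mem {i : ℤ} (hi : i ∈ [(1 : ℤ), -1]) : i * i = 1 := by
  rcases List.mem_pair.1 hi with rfl | rfl <;> rfl

lemma flip_flip {i j k : ℤ} (hi : i ∈ [(1 : ℤ), -1]) (hj : j ∈ [(1 : ℤ), -1])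
    (hk : k ∈ [(1 : ℤ), -1]) (u : GoldenPoint) : flip i j k (flip i j k u) = u := by
  simp only [flip, ← mul_assoc, sq_eq_one_of_mem hi, sq_eq_one_of_mem hj, sq_eq_one_of_mem hk,
    one_mul]

lemma dot_flip {i j k : ℤ} (hi : i ∈ [(1 : ℤ), -1]) (hj : j ∈ [(1 : ℤ), -1])
    (hk : k ∈ [(1 : ℤ), -1]) (u v : GoldenPoint) :
    dot (flip i j k u) (flip i j k v) = dot u v := by
  have hmul : ∀ {i : ℤ}, i ∈ [(1 : ℤ), -1] → ∀ x y : GoldenInt,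
      (⟨i * x.re, i * x.im⟩ * ⟨i * y.re, i * y.im⟩ : GoldenInt) = x * y := by
    intro i hi x y
    rcases List.mem_pair.1 hi with rfl | rfl
    · simp
    · change (⟨_, _⟩ : GoldenInt) = ⟨_, _⟩
      congr 1 <;> ring
  simp only [dot, flip, hmul hi, hmul hj, hmul hk]

end GoldenPoint

open GoldenInt GoldenPoint

/-! ### From the computable conditions to geodesic configurations. -/

namespace GeodesicModel

variable {L R : List GoldenPoint} {n : ℤ} {κ γ : GoldenInt} {r : ℕ}

/-- The tests in `crosses` are the relations `φa + φb = φc + d`, `φa + b = φc + d`, `a + b = (φ -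
1)c + d` and `a + b = c + d`, with `c` a neighbour of `a`. As `b` is not a neighbour of `a`, `c`
differs from both. -/
lemma crossing_of_crosses (h : GeodesicModel L R n κ γ r) (hκ : κ ≠ ⟨n, 0⟩) {a b : GoldenPoint}
    (ha : a ∈ L) (hab : dot a b ≠ κ) (hc : GoldenPoint.crosses L κ a b) :
    ∃ x ∈ L, ∃ y ∈ L, x ≠ a ∧ x ≠ b ∧ ∃ α β ξ η : ℝ, 0 < ξ ∧ 0 ≤ η ∧ ξ + η ≤ α + β ∧
      α • toSpace a + β • toSpace b = ξ • toSpace x + η • toSpace y := by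
  have hφ := Real.one_lt_goldenRatio
  have hφ2 := Real.goldenRatio_lt_two
  have hne : ∀ c, dot a c = κ → c ≠ a ∧ c ≠ b := by
    refine fun c hac => ⟨?_, ?_⟩
    · rintro rfl
      exact hκ (hac.symm.trans (h.dot_self c ha))
    · rintro rfl
      exact hab hac
  simp only [GoldenPoint.crosses, Bool.or_eq_true, List.any_eq_true, List.mem_filter,
    decide_eq_true_eq] at hc
  rcases hc with ((⟨c, ⟨hcL, hca⟩, hd⟩ | ⟨c, ⟨hcL, hca⟩, hd⟩) | ⟨c, ⟨hcL, hca⟩, hd⟩) |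
    ⟨c, ⟨hcL, hca⟩, hd⟩
  · refine ⟨c, hcL, _, hd, (hne c hca).1, (hne c hca).2, φ, φ, φ, 1, by linarith, zero_le_one,
      by linarith, ?_⟩
    rw [toSpace_mulPhi, toSpace_sub, toSpace_add]
    module
  · refine ⟨c, hcL, _, hd, (hne c hca).1, (hne c hca).2, φ, 1, φ, 1, by linarith, zero_le_one,
      le_rfl, ?_⟩
    rw [toSpace_add, toSpace_mulPhi, toSpace_sub]
    module
  · refine ⟨c, hcL, _, hd, (hne c hca).1, (hne c hca).2, 1, 1, φ - 1, 1, by linarith, zero_le_one,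
      by linarith, ?_⟩
    rw [toSpace_sub, toSpace_mulPhi, toSpace_add, toSpace_add]
    module
  · refine ⟨c, hcL, _, hd, (hne c hca).1, (hne c hca).2, 1, 1, 1, 1, one_pos, zero_le_one,
      le_rfl, ?_⟩
    rw [toSpace_sub, toSpace_add]
    module

/-- Sign changes are linear involutions preserving `L` and `dot`. Moving `a` to a representative in
`R` reduces the search to a few starting points. -/
lemma crossing (h : GeodesicModel L R n κ γ r) (hκ : κ ≠ ⟨n, 0⟩) {a b : GoldenPoint}
    (ha : a ∈ L) (hb : b ∈ L) (hne : a ≠ b) (hab : dot a b ≠ κ) :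
    ∃ x ∈ L, ∃ y ∈ L, x ≠ a ∧ x ≠ b ∧ ∃ α β ξ η : ℝ, 0 < ξ ∧ 0 ≤ η ∧ ξ + η ≤ α + β ∧
      α • toSpace a + β • toSpace b = ξ • toSpace x + η • toSpace y := by
  obtain ⟨i, hi, j, hj, k, hk, hR⟩ := h.exists_flip a ha
  have hflip : ∀ u, flip i j k (flip i j k u) = u := flip_flip hi hj hk
  have hinj : Function.Injective (flip i j k) := Function.LeftInverse.injective hflip
  have hab' : dot (flip i j k a) (flip i j k b) ≠ κ := by rwa [dot_flip hi hj hk]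
  have hmem : ∀ u ∈ L, flip i j k u ∈ L := fun u hu => h.flip_mem u hu i hi j hj k hk
  have hcross := ((h.crosses _ hR _ (hmem b hb)).resolve_left (hinj.ne hne)).resolve_left hab'
  obtain ⟨x, hx, y, hy, hxa, hxb, α, β, ξ, η, hξ, hη, hle, heq⟩ :=
    h.crossing_of_crosses hκ (h.subset _ hR) hab' hcross
  refine ⟨flip i j k x, hmem x hx, flip i j k y, hmem y hy, fun h0 => hxa ?_, fun h0 => hxb ?_,
    α, β, ξ, η, hξ, hη, hle, ?_⟩
  · rw [← h0, hflip]
  · rw [← h0, hflip]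
  · have := congrArg (diagonalMap i j k) heq
    simpa only [map_add, map_smul, ← toSpace_flip, hflip] using this

variable {s : ℝ} {N : ℕ}

lemma cos_lt_one (hN : 2 < N) : Real.cos (2 * Real.pi / N) < 1 := by
  have h2 : (2 : ℝ) < N := by exact_mod_cast hN
  have hpi := Real.pi_pos
  rw [← Real.cos_zero]
  refine Real.cos_lt_cos_of_nonneg_of_le_pi le_rfl ?_ (by positivity)
  rw [div_le_iff₀ (by linarith)]
  nlinarith

/-- The hypotheses say `cos (2π/N) = s² κ`, so comparing an inner product with the cosine amounts to
finding the sign of `κ - dot u v`. -/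
lemma inner_smul_toSpace (hs : s ^ 2 * n = 1) (hγ : 2 * Real.cos (2 * Real.pi / N) = toReal γ)
    (hκ : 2 * toReal κ = n * toReal γ) (u v : GoldenPoint) :
    inner ℝ (s • toSpace u) (s • toSpace v) =
      Real.cos (2 * Real.pi / N) - s ^ 2 * toReal (κ - dot u v) := by
  rw [inner_smul_left, inner_smul_right, inner_toSpace, toReal_sub, conj_trivial]
  linear_combination (toReal γ / 2) * hs + s ^ 2 / 2 * hκ - hγ / 2

lemma inner_eq_cos_iff (h : GeodesicModel L R n κ γ r) (hN : 2 < N) (hs : s ^ 2 * n = 1)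
    (hγ : 2 * Real.cos (2 * Real.pi / N) = toReal γ) (hκ : 2 * toReal κ = n * toReal γ)
    {u v : GoldenPoint} (hu : u ∈ L) (hv : v ∈ L) :
    inner ℝ (s • toSpace u) (s • toSpace v) = Real.cos (2 * Real.pi / N) ↔ dot u v = κ := by
  have hs0 : s ^ 2 ≠ 0 := left_ne_zero_of_mul (hs ▸ one_ne_zero)
  rw [inner_smul_toSpace hs hγ hκ]
  constructor
  · intro h0
    have hzero : toReal (κ - dot u v) = 0 := by
      refine (mul_eq_zero.1 ?_).resolve_left hs0
      linarith
    by_contra hd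
    by_cases huv : u = v
    · rw [← huv, h.dot_self u hu, toReal_sub, toReal_int] at hzero
      have hcos := cos_lt_one hN
      have h1 : 2 * Real.cos (2 * Real.pi / N) = 2 := by
        rw [hγ]
        linear_combination (-toReal γ + 2) * hs - s ^ 2 * hκ + 2 * s ^ 2 * hzero
      linarith
    · exact (toReal_pos (((h.trichotomy u hu v hv).resolve_left huv).resolve_left hd)).ne' hzero
  · intro hd
    rw [hd, toReal_sub, sub_self, mul_zero, sub_zero]

lemma isGeodesicConfiguration (h : GeodesicModel L R n κ γ r) (hr : 0 < r) (hN : 2 < N)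
    (hs0 : 0 < s) (hs : s ^ 2 * n = 1) (hγ : 2 * Real.cos (2 * Real.pi / N) = toReal γ)
    (hκ : 2 * toReal κ = n * toReal γ) :
    Set.InjOn (fun u => s • toSpace u) {u | u ∈ L} ∧
    IsGeodesicConfiguration ((L.map fun u => s • toSpace u).toFinset) N r := by
  have hinner := fun u v => inner_smul_toSpace (N := N) hs hγ hκ u v
  have hself : ∀ u ∈ L, inner ℝ (s • toSpace u) (s • toSpace u) = (1 : ℝ) := by
    intro u hu
    rw [inner_smul_left, inner_smul_right, inner_toSpace, h.dot_self u hu, toReal_int,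
      conj_trivial]
    linear_combination hs
  have hcos := cos_lt_one hN
  have hlt : ∀ u ∈ L, ∀ v ∈ L, u ≠ v → dot u v ≠ κ →
      inner ℝ (s • toSpace u) (s • toSpace v) < Real.cos (2 * Real.pi / N) := by
    intro u hu v hv huv hd
    have hpos := toReal_pos (((h.trichotomy u hu v hv).resolve_left huv).resolve_left hd)
    rw [hinner]
    have : 0 < s ^ 2 * toReal (κ - dot u v) := by positivity
    linarith
  have heq : ∀ u v, dot u v = κ →
      inner ℝ (s • toSpace u) (s • toSpace v) = Real.cos (2 * Real.pi / N) := by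
    intro u v hd
    rw [hinner, hd, toReal_sub, sub_self, mul_zero, sub_zero]
  have hκn : κ ≠ ⟨n, 0⟩ := by
    intro h0
    obtain ⟨u, hu⟩ := List.exists_mem_of_ne_nil L h.ne_nil
    have := heq u u ((h.dot_self u hu).trans h0.symm)
    rw [hself u hu] at this
    exact hcos.ne this.symm
  have hiff : ∀ u ∈ L, ∀ v ∈ L, inner ℝ (s • toSpace u) (s • toSpace v) =
      Real.cos (2 * Real.pi / N) ↔ dot u v = κ := fun u hu v hv =>
    h.inner_eq_cos_iff hN hs hγ hκ hu hv
  have hinj : Set.InjOn (fun u => s • toSpace u) {u | u ∈ L} := by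
    intro u hu v hv huv
    by_contra hne
    have h1 : inner ℝ (s • toSpace u) (s • toSpace v) = (1 : ℝ) := by
      rw [← show s • toSpace u = s • toSpace v from huv, hself u hu]
    by_cases hd : dot u v = κ
    · exact hcos.ne ((heq u v hd).symm.trans h1)
    · exact (hlt u hu v hv hne hd).not_gt (h1 ▸ hcos)
  have hmem : ∀ x, x ∈ (L.map fun u => s • toSpace u).toFinset ↔
      ∃ u ∈ L, s • toSpace u = x := by simp
  refine ⟨hinj, ?_⟩
  refine
    { lt_one := hcos
      norm_eq_one := ?_
      neg_mem := ?_
      inner_eq_or_lt := ?_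
      crossing := ?_
      two_lt := hN
      nonempty := ?_
      degree_pos := hr
      continue_mem := ?_
      degree := ?_ }
  · intro x hx
    obtain ⟨u, hu, rfl⟩ := (hmem x).1 hx
    have := hself u hu
    rw [real_inner_self_eq_norm_sq] at this
    exact (pow_eq_one_iff_of_nonneg (norm_nonneg _) two_ne_zero).1 this
  · intro x hx
    obtain ⟨u, hu, rfl⟩ := (hmem x).1 hx
    refine (hmem _).2 ⟨flip (-1) (-1) (-1) u,
      h.flip_mem u hu _ (by simp) _ (by simp) _ (by simp), ?_⟩
    rw [toSpace_flip]
    ext l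
    fin_cases l <;> simp [diagonalMap]
  · intro x hx y hy hxy
    obtain ⟨u, hu, rfl⟩ := (hmem x).1 hx
    obtain ⟨v, hv, rfl⟩ := (hmem y).1 hy
    by_cases hd : dot u v = κ
    · exact Or.inl (heq u v hd)
    · exact Or.inr (hlt u hu v hv (fun h0 => hxy (by rw [h0])) hd)
  · intro x hx y hy hxy hne
    obtain ⟨u, hu, rfl⟩ := (hmem x).1 hx
    obtain ⟨v, hv, rfl⟩ := (hmem y).1 hy
    obtain ⟨p, hp, q, hq, hpu, hpv, α, β, ξ, η, hξ, hη, hle, hcomb⟩ :=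
      h.crossing hκn hu hv (fun h0 => hxy (by rw [h0])) fun h0 => hne (heq u v h0)
    refine ⟨_, (hmem _).2 ⟨p, hp, rfl⟩, _, (hmem _).2 ⟨q, hq, rfl⟩, hinj.ne hp hu hpu,
      hinj.ne hp hv hpv, α, β, ξ, η, hξ, hη, hle, ?_⟩
    simp only [smul_comm _ s, ← smul_add, hcomb]
  · obtain ⟨u, hu⟩ := List.exists_mem_of_ne_nil L h.ne_nil
    exact ⟨_, (hmem _).2 ⟨u, hu, rfl⟩⟩
  · intro x hx y hy hxy
    obtain ⟨u, hu, rfl⟩ := (hmem x).1 hx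
    obtain ⟨v, hv, rfl⟩ := (hmem y).1 hy
    refine (hmem _).2 ⟨_, h.continue_mem u hu v hv ((hiff u hu v hv).1 hxy), ?_⟩
    rw [toSpace_sub, toSpace_scale, hγ]
    module
  · intro x hx
    obtain ⟨u, hu, rfl⟩ := (hmem x).1 hx
    have hset : (L.map fun u => s • toSpace u).toFinset.filter
        (fun y => inner ℝ (s • toSpace u) y = Real.cos (2 * Real.pi / N)) =
        ((L.filter fun v => dot u v = κ).map fun u => s • toSpace u).toFinset := by
      ext y
      simp only [Finset.mem_filter, hmem, List.mem_toFinset, List.mem_map, List.mem_filter,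
        decide_eq_true_eq]
      constructor
      · rintro ⟨⟨v, hv, rfl⟩, h0⟩
        exact ⟨v, ⟨hv, (hiff u hu v hv).1 h0⟩, rfl⟩
      · rintro ⟨v, ⟨hv, h0⟩, rfl⟩
        exact ⟨⟨v, hv, rfl⟩, heq u v h0⟩
    rw [hset, List.toFinset_card_of_nodup, List.length_map, h.degree u hu]
    exact (h.nodup.filter _).map_on fun v hv w hw =>
      hinj (List.mem_filter.1 hv).1 (List.mem_filter.1 hw).1

end GeodesicModel

/-! ### Monomial sums over normalized points. -/

namespace GoldenPoint

/-- The normalization of a point. -/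
def normalized (u : GoldenPoint) : EuclideanSpace ℝ (Fin 3) := NormedSpace.normalize (toSpace u)

lemma norm_toSpace_sq (u : GoldenPoint) : ‖toSpace u‖ ^ 2 = toReal (dot u u) := by
  rw [← real_inner_self_eq_norm_sq, inner_toSpace]

lemma normalized_flip {i j k : ℤ} (hi : i ∈ [(1 : ℤ), -1]) (hj : j ∈ [(1 : ℤ), -1])
    (hk : k ∈ [(1 : ℤ), -1]) (u : GoldenPoint) :
    normalized (flip i j k u) = diagonalMap i j k (normalized u) := by
  have hnorm : ‖toSpace (flip i j k u)‖ = ‖toSpace u‖ := by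
    rw [← sq_eq_sq₀ (norm_nonneg _) (norm_nonneg _), norm_toSpace_sq, norm_toSpace_sq,
      dot_flip hi hj hk]
  rw [normalized, normalized, NormedSpace.normalize, NormedSpace.normalize, hnorm, toSpace_flip, map_smul]

/-- Changing the sign of coordinate `l` permutes `L` and negates the monomial. -/
lemma sum_normalized_odd {L : List GoldenPoint} (hnd : L.Nodup)
    (hflip : ∀ u ∈ L, ∀ i ∈ [(1 : ℤ), -1], ∀ j ∈ [(1 : ℤ), -1], ∀ k ∈ [(1 : ℤ), -1],
      flip i j k u ∈ L) {d : Fin 3 → ℕ} {l : Fin 3} (hl : Odd (d l)) :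
    (L.map fun u => ∏ m, normalized u m ^ d m).sum = 0 := by
  have key : ∀ i ∈ [(1 : ℤ), -1], ∀ j ∈ [(1 : ℤ), -1], ∀ k ∈ [(1 : ℤ), -1],
      (i : ℝ) ^ d 0 * j ^ d 1 * k ^ d 2 = -1 →
      (L.map fun u => ∏ m, normalized u m ^ d m).sum = 0 := by
    intro i hi j hj k hk hsign
    rw [← List.sum_toFinset _ hnd]
    have hneg : ∀ u, ∏ m, normalized (flip i j k u) m ^ d m = -∏ m, normalized u m ^ d m := by
      intro u
      rw [normalized_flip hi hj hk, Fin.prod_univ_three, Fin.prod_univ_three]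
      simp only [diagonalMap, LinearMap.coe_mk, AddHom.coe_mk, PiLp.toLp_apply,
        Matrix.cons_val_zero, Matrix.cons_val_one, Matrix.cons_val, mul_pow]
      linear_combination (normalized u 0 ^ d 0 * normalized u 1 ^ d 1 * normalized u 2 ^ d 2) * hsign
    have hsum : ∑ u ∈ L.toFinset, ∏ m, normalized u m ^ d m =
        ∑ u ∈ L.toFinset, -∏ m, normalized u m ^ d m := by
      refine Finset.sum_nbij' (flip i j k) (flip i j k) ?_ ?_ ?_ ?_ ?_
      · exact fun u hu => List.mem_toFinset.2 (hflip u (List.mem_toFinset.1 hu) i hi j hj k hk)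
      · exact fun u hu => List.mem_toFinset.2 (hflip u (List.mem_toFinset.1 hu) i hi j hj k hk)
      · exact fun u _ => flip_flip hi hj hk u
      · exact fun u _ => flip_flip hi hj hk u
      · exact fun u _ => by rw [hneg, neg_neg]
    rw [Finset.sum_neg_distrib] at hsum
    linarith
  fin_cases l
  · exact key (-1) (by simp) 1 (by simp) 1 (by simp) (by simpa using hl.neg_one_pow)
  · exact key 1 (by simp) (-1) (by simp) 1 (by simp) (by simpa using hl.neg_one_pow)
  · exact key 1 (by simp) 1 (by simp) (-1) (by simp) (by simpa using hl.neg_one_pow)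

/-- Even exponents involve only `1 / ‖u‖² = μ / Q`, so no square root enters and the arithmetic
stays in `ℤ[φ]` up to a power of `Q`. -/
lemma sum_normalized_even {L : List GoldenPoint} {μ : GoldenInt} {Q : ℤ} (hQ : Q ≠ 0)
    (hμ : ∀ u ∈ L, dot u u * μ = ⟨Q, 0⟩) (e : Fin 3 → ℕ) :
    (L.map fun u => ∏ m, normalized u m ^ (2 * e m)).sum =
      (toReal μ / Q) ^ (∑ m, e m) * toReal (moment (e 0) (e 1) (e 2) L) := by
  have hQ' : (Q : ℝ) ≠ 0 := by exact_mod_cast hQ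
  induction L with
  | nil => simp [moment, toReal_zero]
  | cons u L ih =>
    have hu := congrArg toReal (hμ u (by simp))
    rw [toReal_mul, toReal_int, ← norm_toSpace_sq] at hu
    have hinv : (‖toSpace u‖⁻¹) ^ 2 = toReal μ / Q := by
      have h0 : ‖toSpace u‖ ^ 2 ≠ 0 := fun h0 => hQ' (by rw [← hu, h0, zero_mul])
      rw [inv_pow, ← hu]
      have h1 : toReal μ ≠ 0 := fun h1 => hQ' (by rw [← hu, h1, mul_zero])
      field_simp
    rw [List.map_cons, List.sum_cons, ih fun v hv => hμ v (List.mem_cons_of_mem u hv), moment,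
      toReal_add, mul_add]
    congr 1
    rw [← hinv, ← Finset.prod_pow_eq_pow_sum, toReal_mul, toReal_mul, toReal_power, toReal_power,
      toReal_power]
    simp only [normalized, NormedSpace.normalize, PiLp.smul_apply, smul_eq_mul, mul_pow,
      Fin.prod_univ_three, pow_mul]
    simp only [toSpace, PiLp.toLp_apply, Matrix.cons_val_zero, Matrix.cons_val_one,
      Matrix.cons_val]
    ring

end GoldenPoint

lemma coe_toFinset_map (f : GoldenPoint → EuclideanSpace ℝ (Fin 3)) (L : List GoldenPoint) :
    ((L.map f).toFinset : Set (EuclideanSpace ℝ (Fin 3))) = f '' {u | u ∈ L} := by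
  ext x
  simp

/-! ### Projected vertices of the polytopes supplying the point sets. -/

namespace ExposedModel

variable {L : List GoldenPoint}

lemma inner_lt (h : ExposedModel L) {u v : GoldenPoint} (hu : u ∈ L) (hv : v ∈ L) (huv : u ≠ v) :
    inner ℝ (toSpace u) (toSpace v) < inner ℝ (toSpace u) (toSpace u) := by
  have := toReal_pos ((h.exposed u hu v hv).resolve_left huv)
  rw [toReal_sub] at this
  rw [inner_toSpace, inner_toSpace]
  linarith

lemma toSpace_ne_zero (h : ExposedModel L) {u : GoldenPoint} (hu : u ∈ L) : toSpace u ≠ 0 := by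
  intro h0
  have hlen := h.one_lt
  rcases Classical.em (L = [u]) with rfl | hL
  · simp at hlen
  obtain ⟨v, hv, hvu⟩ : ∃ v ∈ L, v ≠ u := by
    by_contra! hall
    have hsub : L.toFinset ⊆ {u} := fun v hv =>
      Finset.mem_singleton.2 (hall v (List.mem_toFinset.1 hv))
    have := Finset.card_le_card hsub
    rw [List.toFinset_card_of_nodup h.nodup, Finset.card_singleton] at this
    omega
  have := h.inner_lt hu hv hvu.symm
  simp [h0] at this

lemma injOn_normalized (h : ExposedModel L) : Set.InjOn normalized {u | u ∈ L} := by
  intro u hu v hv huv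
  by_contra hne
  have hnu := norm_pos_iff.2 (h.toSpace_ne_zero hu)
  have hnv := norm_pos_iff.2 (h.toSpace_ne_zero hv)
  have h1 := h.inner_lt hu hv hne
  have h2 := h.inner_lt hv hu (Ne.symm hne)
  have hu' : toSpace u = ‖toSpace u‖ • normalized u := by
    rw [normalized, NormedSpace.normalize, smul_inv_smul₀ hnu.ne']
  have hv' : toSpace v = ‖toSpace v‖ • normalized u := by
    rw [huv, normalized, NormedSpace.normalize, smul_inv_smul₀ hnv.ne']
  have hn : inner ℝ (normalized u) (normalized u) = (1 : ℝ) := by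
    rw [real_inner_self_eq_norm_sq, normalized, NormedSpace.norm_normalize (h.toSpace_ne_zero hu),
      one_pow]
  have huv' : inner ℝ (toSpace u) (toSpace v) = ‖toSpace u‖ * ‖toSpace v‖ := by
    rw [hv', norm_smul, norm_norm, hu', norm_smul, norm_norm, inner_smul_left, inner_smul_right, hn]
    have : ‖normalized u‖ = 1 := NormedSpace.norm_normalize (h.toSpace_ne_zero hu)
    simp [this]
  rw [huv', real_inner_self_eq_norm_sq] at h1
  rw [real_inner_comm, huv', real_inner_self_eq_norm_sq] at h2
  -- With norms `p`, `q` on one ray, `p q < p²` and `p q < q²` contradict each other.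
  nlinarith

lemma sphericalVertices_eq (h : ExposedModel L) {s : ℝ} (hs : 0 < s) :
    sphericalVertices (convexHull ℝ ((fun u => s • toSpace u) '' {u | u ∈ L})) =
      normalized '' {u | u ∈ L} := by
  rw [sphericalVertices, extremePoints_convexHull_eq, image_image]
  · simp only [NormedSpace.normalize_smul_of_pos hs]
    rfl
  · rintro _ ⟨u, hu, rfl⟩ _ ⟨v, hv, rfl⟩ hne
    simp only [inner_smul_left, inner_smul_right, conj_trivial]
    have := h.inner_lt hu hv (by rintro rfl; exact hne rfl)
    gcongr

lemma ncard_normalized (h : ExposedModel L) : (normalized '' {u | u ∈ L}).ncard = L.length := by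
  rw [← coe_toFinset_map, Set.ncard_coe_finset, List.toFinset_card_of_nodup, List.length_map]
  exact h.nodup.map_on fun u hu v hv => h.injOn_normalized hu hv

lemma finsum_normalized (h : ExposedModel L) (f : EuclideanSpace ℝ (Fin 3) → ℝ) :
    ∑ᶠ x ∈ normalized '' {u | u ∈ L}, f x = (L.map fun u => f (normalized u)).sum := by
  rw [← coe_toFinset_map, finsum_mem_coe_finset, List.sum_toFinset, List.map_map]
  · rfl
  · exact h.nodup.map_on fun u hu v hv => h.injOn_normalized hu hv

end ExposedModel

/-! ### Cubature on the sphere -/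

section Cubature

open scoped Nat

variable {L₁ L₂ L₃ : List GoldenPoint} {μ₁ μ₂ μ₃ : GoldenInt} {Q W₁ W₂ W : ℤ} {K : ℕ}

lemma CubatureModel.even (h : CubatureModel L₁ L₂ L₃ μ₁ μ₂ μ₃ Q W₁ W₂ W K) (hQ : Q ≠ 0)
    (hW : W ≠ 0) (h₁ : ∀ u ∈ L₁, dot u u * μ₁ = ⟨Q, 0⟩) (h₂ : ∀ u ∈ L₂, dot u u * μ₂ = ⟨Q, 0⟩)
    (h₃ : ∀ u ∈ L₃, dot u u * μ₃ = ⟨Q, 0⟩) {e : Fin 3 → ℕ} (he : ∑ m, e m ≤ K) :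
    (W₁ / W : ℝ) * ((L₁ ++ L₂).map fun u => ∏ m, normalized u m ^ (2 * e m)).sum +
      W₂ / W * (L₃.map fun u => ∏ m, normalized u m ^ (2 * e m)).sum =
      sphereIntegral fun x => ∏ m, x m ^ (2 * e m) := by
  have hQ' : (Q : ℝ) ≠ 0 := by exact_mod_cast hQ
  have hW' : (W : ℝ) ≠ 0 := by exact_mod_cast hW
  have hdf : ((2 * (e 0 + e 1 + e 2) + 1)‼ : ℝ) ≠ 0 := by
    exact_mod_cast (Nat.doubleFactorial_pos _).ne'
  rw [List.map_append, List.sum_append, sum_normalized_even hQ h₁, sum_normalized_even hQ h₂,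
    sum_normalized_even hQ h₃, sphereIntegral_even]
  rw [Fin.sum_univ_three] at he ⊢
  rw [Fin.prod_univ_three]
  have key := congrArg toReal (h (e 0) (List.mem_range.2 (by omega)) (e 1)
    (List.mem_range.2 (by omega)) (e 2) (List.mem_range.2 (by omega)) he)
  simp only [toReal_mul, toReal_add, toReal_int, toReal_power, Int.cast_mul, Int.cast_pow,
    Int.cast_natCast] at key
  rw [div_pow, div_pow, div_pow]
  field_simp
  linear_combination key

/-- Checking even monomials up to degree `2K` suffices for degree `2K + 1`: a monomial without odd
exponents has even degree, and all others vanish on both sides. -/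
lemma CubatureModel.eval (h : CubatureModel L₁ L₂ L₃ μ₁ μ₂ μ₃ Q W₁ W₂ W K) (hQ : Q ≠ 0)
    (hW : W ≠ 0) (h₁ : ∀ u ∈ L₁, dot u u * μ₁ = ⟨Q, 0⟩) (h₂ : ∀ u ∈ L₂, dot u u * μ₂ = ⟨Q, 0⟩)
    (h₃ : ∀ u ∈ L₃, dot u u * μ₃ = ⟨Q, 0⟩) (hodd : ∀ (d : Fin 3 → ℕ) (l : Fin 3), Odd (d l) →
      ((L₁ ++ L₂).map fun u => ∏ m, normalized u m ^ d m).sum = 0 ∧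
        (L₃.map fun u => ∏ m, normalized u m ^ d m).sum = 0)
    {P : MvPolynomial (Fin 3) ℝ} (hP : P.totalDegree ≤ 2 * K + 1) :
    (W₁ / W : ℝ) * ((L₁ ++ L₂).map fun u => MvPolynomial.eval (fun i => normalized u i) P).sum +
      W₂ / W * (L₃.map fun u => MvPolynomial.eval (fun i => normalized u i) P).sum =
      sphereIntegral fun x => MvPolynomial.eval (fun i => x i) P := by
  have hexpand : ∀ L : List GoldenPoint,
      (L.map fun u => MvPolynomial.eval (fun i => normalized u i) P).sum =
        ∑ d ∈ P.support, P.coeff d * (L.map fun u => ∏ m, normalized u m ^ d m).sum := by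
    intro L
    induction L with
    | nil => simp
    | cons u L ih =>
      simp only [List.map_cons, List.sum_cons, ih, mul_add, Finset.sum_add_distrib]
      rw [MvPolynomial.eval_eq']
  rw [hexpand, hexpand, sphereIntegral_eval, Finset.mul_sum, Finset.mul_sum,
    ← Finset.sum_add_distrib]
  refine Finset.sum_congr rfl fun d hd => ?_
  have hmono : (W₁ / W : ℝ) * ((L₁ ++ L₂).map fun u => ∏ m, normalized u m ^ d m).sum +
      W₂ / W * (L₃.map fun u => ∏ m, normalized u m ^ d m).sum =
      sphereIntegral fun x => ∏ m, x m ^ d m := by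
    by_cases hex : ∃ l, Odd (d l)
    · obtain ⟨l, hl⟩ := hex
      rw [(hodd d l hl).1, (hodd d l hl).2, sphereIntegral_odd hl, mul_zero, mul_zero, add_zero]
    · have heven : ∀ l, d l = 2 * (d l / 2) := fun l =>
        (Nat.two_mul_div_two_of_even (Nat.not_odd_iff_even.1 fun h0 => hex ⟨l, h0⟩)).symm
      have hdeg : ∑ l, d l ≤ 2 * K + 1 := by
        have := (MvPolynomial.le_totalDegree hd).trans hP
        rwa [Finsupp.sum_fintype _ _ fun _ => rfl] at this
      have hK : ∑ l, d l / 2 ≤ K := by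
        have : ∑ l, d l = 2 * ∑ l, d l / 2 := by
          rw [Finset.mul_sum]
          exact Finset.sum_congr rfl fun l _ => heven l
        omega
      have := h.even hQ hW h₁ h₂ h₃ (e := fun l => d l / 2) hK
      simpa only [← heven] using this
  rw [← hmono]
  ring

end Cubature

/-! ### Existence of Euler cycles -/

section EulerExistence

open SimpleGraph

lemma isChain_of_forall_zip {α : Type*} {r : α → α → Prop} {l : List α}
    (h : ∀ p ∈ l.zip l.tail, r p.1 p.2) : l.IsChain r := by
  induction l with
  | nil => exact .nil
  | cons a l ih =>
    cases l with
    | nil => exact .singleton a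
    | cons b l =>
      refine .cons_cons (h (a, b) (by simp)) (ih fun p hp => h p ?_)
      rw [List.tail_cons, List.zip_cons_cons]
      exact List.mem_cons_of_mem _ hp

lemma exists_isEulerCycle {V : Type*} {G : SimpleGraph V} {l : List V} (hne : l ≠ [])
    (hclosed : l.head hne = l.getLast hne) (hchain : l.IsChain G.Adj)
    (hnodup : (List.zipWith (s(·, ·)) l l.tail).Nodup)
    (hcov : ∀ a b, G.Adj a b → s(a, b) ∈ List.zipWith (s(·, ·)) l l.tail) :
    ∃ (v : V) (w : G.Walk v v), IsEulerCycle w := by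
  classical
  refine ⟨_, (Walk.ofSupport l hne hchain).copy rfl hclosed.symm, ?_⟩
  have hedges : ((Walk.ofSupport l hne hchain).copy rfl hclosed.symm).edges =
      List.zipWith (s(·, ·)) l l.tail := by
    rw [Walk.edges_copy, Walk.edges_eq_zipWith_support, Walk.support_ofSupport]
  refine (Walk.isEulerian_iff _).2 ⟨⟨by rw [hedges]; exact hnodup⟩, fun e => ?_⟩
  rw [hedges]
  induction e with
  | _ a b => exact hcov a b

lemma CircuitModel.exists_isEulerCycle {L C : List GoldenPoint} {κ : GoldenInt}
    (h : CircuitModel L C κ) {f : GoldenPoint → EuclideanSpace ℝ (Fin 3)}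
    (hf : Set.InjOn f {u | u ∈ L}) {G : SimpleGraph (EuclideanSpace ℝ (Fin 3))}
    (hadj : ∀ u ∈ L, ∀ v ∈ L, dot u v = κ → G.Adj (f u) (f v))
    (hG : ∀ x y, G.Adj x y → ∃ u ∈ L, ∃ v ∈ L, dot u v = κ ∧ x = f u ∧ y = f v) :
    ∃ (v : _) (w : G.Walk v v), IsEulerCycle w := by
  have hzip : List.zipWith (s(·, ·)) (C.map f) (C.map f).tail =
      (C.zip C.tail).map fun p => s(f p.1, f p.2) := by
    rw [← List.map_tail, List.zipWith_map, List.zip, List.map_zipWith]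
  refine HybridDesign.exists_isEulerCycle (l := C.map f) (by simpa using h.ne_nil) ?_ ?_ ?_ ?_
  · have h1 := h.closed
    rw [List.head?_eq_some_head h.ne_nil, List.getLast?_eq_some_getLast h.ne_nil] at h1
    rw [List.head_map, List.getLast_map, Option.some.inj h1]
  · rw [List.isChain_map]
    exact isChain_of_forall_zip fun p hp =>
      hadj _ (h.adj p hp).1 _ (h.adj p hp).2.1 (h.adj p hp).2.2
  · rw [hzip]
    refine List.Nodup.map_on ?_ (h.pairwise.imp fun h0 => h0.1)
    intro p hp q hq hpq
    by_contra hne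
    obtain ⟨hp1, hp2, -⟩ := h.adj p hp
    obtain ⟨hq1, hq2, -⟩ := h.adj q hq
    -- Symmetry lets the pairwise condition be used regardless of which of the two steps comes
    -- earlier in the list.
    have : Std.Symm fun p q : GoldenPoint × GoldenPoint => p ≠ q.swap :=
      ⟨fun p q hpq hqp => hpq (by rw [hqp, Prod.swap_swap])⟩
    have hsw := (h.pairwise.imp And.right).forall hp hq hne
    rcases Sym2.eq_iff.1 hpq with ⟨h1, h2⟩ | ⟨h1, h2⟩
    · exact hne (Prod.ext (hf hp1 hq1 h1) (hf hp2 hq2 h2))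
    · exact hsw (Prod.ext (hf hp1 hq2 h1) (hf hp2 hq1 h2))
  · intro x y hxy
    obtain ⟨u, hu, v, hv, huv, rfl, rfl⟩ := hG x y hxy
    rw [hzip]
    rcases h.covers u hu v hv huv with h0 | h0
    · exact List.mem_map.2 ⟨_, h0, rfl⟩
    · exact List.mem_map.2 ⟨_, h0, Sym2.eq_swap⟩

end EulerExistence

/-! ### The polytopes as convex hulls of explicit points -/

namespace GoldenPoint

/-- The points with coordinates `±a`, `±b`, `±c`. -/
def box (a b c : GoldenInt) : List GoldenPoint :=
  [a, -a].flatMap fun x => [b, -b].flatMap fun y => [c, -c].map fun z => ⟨x, y, z⟩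

/-- The points obtained from `(a, b, c)` by cyclic permutations and sign changes. -/
def orbit (a b c : GoldenInt) : List GoldenPoint := box a b c ++ box c a b ++ box b c a

lemma mem_box {a b c : GoldenInt} {u : GoldenPoint} :
    u ∈ box a b c ↔ u.x ∈ [a, -a] ∧ u.y ∈ [b, -b] ∧ u.z ∈ [c, -c] := by
  obtain ⟨x, y, z⟩ := u
  simp only [box, List.mem_flatMap, List.mem_map, GoldenPoint.mk.injEq]
  constructor
  · rintro ⟨x, hx, y, hy, z, hz, rfl, rfl, rfl⟩
    exact ⟨hx, hy, hz⟩
  · rintro ⟨hx, hy, hz⟩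
    exact ⟨x, hx, y, hy, z, hz, rfl, rfl, rfl⟩

lemma abs_eq_iff_exists {s : ℝ} (hs : 0 ≤ s) {a : GoldenInt} (ha : 0 ≤ toReal a) (r : ℝ) :
    |r| = s * toReal a ↔ ∃ y ∈ [a, -a], s * toReal y = r := by
  rw [abs_eq (mul_nonneg hs ha)]
  simp [toReal_neg, eq_comm]

lemma image_box {s : ℝ} (hs : 0 ≤ s) {a b c : GoldenInt} (ha : 0 ≤ toReal a) (hb : 0 ≤ toReal b)
    (hc : 0 ≤ toReal c) : (fun u => s • toSpace u) '' {u | u ∈ box a b c} =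
      {x | |x 0| = s * toReal a ∧ |x 1| = s * toReal b ∧ |x 2| = s * toReal c} := by
  ext x
  simp only [mem_image, mem_ofPred_eq, mem_box, abs_eq_iff_exists hs ha, abs_eq_iff_exists hs hb,
    abs_eq_iff_exists hs hc]
  constructor
  · rintro ⟨u, ⟨hx, hy, hz⟩, rfl⟩
    exact ⟨⟨u.x, hx, rfl⟩, ⟨u.y, hy, rfl⟩, ⟨u.z, hz, rfl⟩⟩
  · rintro ⟨⟨p, hp, h0⟩, ⟨q, hq, h1⟩, ⟨r, hr, h2⟩⟩
    refine ⟨⟨p, q, r⟩, ⟨hp, hq, hr⟩, ?_⟩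
    ext i
    fin_cases i
    exacts [h0, h1, h2]

/-- Only membership is compared, since `orbit` repeats points when a coordinate is zero or
coordinates coincide. -/
lemma signedCyclic_eq {s : ℝ} (hs : 0 ≤ s) {a b c : GoldenInt} (ha : 0 ≤ toReal a)
    (hb : 0 ≤ toReal b) (hc : 0 ≤ toReal c) {L : List GoldenPoint}
    (h₁ : ∀ u ∈ L, u ∈ orbit a b c) (h₂ : ∀ u ∈ orbit a b c, u ∈ L) :
    signedCyclic (s * toReal a) (s * toReal b) (s * toReal c) =
      (fun u => s • toSpace u) '' {u | u ∈ L} := by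
  have hL : {u | u ∈ L} = {u | u ∈ box a b c} ∪ {u | u ∈ box c a b} ∪ {u | u ∈ box b c a} := by
    ext u
    have : u ∈ L ↔ u ∈ orbit a b c := ⟨h₁ u, h₂ u⟩
    simp [this, orbit, or_assoc]
  rw [hL, image_union, image_union, image_box hs ha hb hc, image_box hs hc ha hb,
    image_box hs hb hc ha]
  ext x
  simp only [signedCyclic, mem_ofPred_eq, mem_union]
  constructor
  · rintro ⟨k, h0, h1, h2⟩
    fin_cases k
    · exact Or.inl (Or.inl ⟨h0, h1, h2⟩)
    · exact Or.inl (Or.inr ⟨h2, h0, h1⟩)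
    · exact Or.inr ⟨h1, h2, h0⟩
  · rintro ((⟨h0, h1, h2⟩ | ⟨h0, h1, h2⟩) | ⟨h0, h1, h2⟩)
    · exact ⟨0, h0, h1, h2⟩
    · exact ⟨1, h1, h2, h0⟩
    · exact ⟨2, h2, h0, h1⟩

lemma setOf_mem_append (L₁ L₂ : List GoldenPoint) :
    {u | u ∈ L₁ ++ L₂} = {u | u ∈ L₁} ∪ {u | u ∈ L₂} := by
  ext u
  simp

end GoldenPoint

lemma toReal_phi : toReal ⟨0, 1⟩ = φ := by simp [toReal]

lemma toReal_inv_phi : toReal ⟨-1, 1⟩ = φ⁻¹ := by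
  rw [Real.inv_goldenRatio, ← Real.one_sub_goldenConj]
  simp only [toReal, Int.cast_neg, Int.cast_one]
  ring

lemma octahedron_eq :
    octahedron = convexHull ℝ ((fun u => (1 / 2 : ℝ) • toSpace u) '' {u | u ∈ octahedronPoints}) := by
  have h := signedCyclic_eq (s := 1 / 2) (a := ⟨2, 0⟩) (b := 0) (c := 0) (L := octahedronPoints)
    (by norm_num) (by norm_num [toReal_int]) toReal_zero.ge toReal_zero.ge (by decide +kernel)
    (by decide +kernel)
  rw [octahedron, ← h, toReal_int, toReal_zero]
  norm_num

lemma cuboctahedron_eq : cuboctahedron =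
    convexHull ℝ ((fun u => (1 / √2 : ℝ) • toSpace u) '' {u | u ∈ cuboctahedronPoints}) := by
  have h := signedCyclic_eq (s := 1 / √2) (a := 1) (b := 1) (c := 0) (L := cuboctahedronPoints)
    (by positivity) (toReal_one ▸ zero_le_one) (toReal_one ▸ zero_le_one) toReal_zero.ge
    (by decide +kernel) (by decide +kernel)
  rw [cuboctahedron, ← h, toReal_one, toReal_zero, mul_one, mul_zero]

lemma rhombicDodecahedron_eq : rhombicDodecahedron =
    convexHull ℝ ((fun u => (1 / 2 : ℝ) • toSpace u) '' {u | u ∈ octahedronPoints ++ cubePoints}) := by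
  have h₁ := signedCyclic_eq (s := 1 / 2) (a := ⟨2, 0⟩) (b := 0) (c := 0) (L := octahedronPoints)
    (by norm_num) (by norm_num [toReal_int]) toReal_zero.ge toReal_zero.ge (by decide +kernel)
    (by decide +kernel)
  have h₂ := signedCyclic_eq (s := 1 / 2) (a := 1) (b := 1) (c := 1) (L := cubePoints)
    (by norm_num) (toReal_one ▸ zero_le_one) (toReal_one ▸ zero_le_one) (toReal_one ▸ zero_le_one)
    (by decide +kernel) (by decide +kernel)
  rw [rhombicDodecahedron, setOf_mem_append, image_union, ← h₁, ← h₂, toReal_int, toReal_zero,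
    toReal_one]
  norm_num

lemma icosahedron_eq : icosahedron =
    convexHull ℝ ((fun u => (1 / 2 : ℝ) • toSpace u) '' {u | u ∈ icosahedronPoints}) := by
  have h := signedCyclic_eq (s := 1 / 2) (a := ⟨0, 1⟩) (b := 1) (c := 0) (L := icosahedronPoints)
    (by norm_num) (toReal_phi ▸ Real.goldenRatio_pos.le) (toReal_one ▸ zero_le_one) toReal_zero.ge
    (by decide +kernel) (by decide +kernel)
  rw [icosahedron, ← h, toReal_phi, toReal_zero, toReal_one, one_div_mul_eq_div, mul_one, mul_zero]

lemma icosidodecahedron_eq : icosidodecahedron =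
    convexHull ℝ ((fun u => (1 / 2 : ℝ) • toSpace u) '' {u | u ∈ icosidodecahedronPoints}) := by
  have h₁ := signedCyclic_eq (s := 1 / 2) (a := ⟨2, 0⟩) (b := 0) (c := 0)
    (L := icosidodecahedronPoints.take 6)
    (by norm_num) (by norm_num [toReal_int]) toReal_zero.ge toReal_zero.ge (by decide +kernel)
    (by decide +kernel)
  have h₂ := signedCyclic_eq (s := 1 / 2) (a := ⟨0, 1⟩) (b := ⟨-1, 1⟩) (c := 1)
    (L := icosidodecahedronPoints.drop 6)
    (by norm_num) (toReal_phi ▸ Real.goldenRatio_pos.le)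
    (toReal_inv_phi ▸ inv_nonneg.2 Real.goldenRatio_pos.le) (toReal_one ▸ zero_le_one)
    (by decide +kernel) (by decide +kernel)
  rw [← List.take_append_drop 6 icosidodecahedronPoints, setOf_mem_append, image_union, ← h₁, ← h₂,
    icosidodecahedron, toReal_phi, toReal_inv_phi, toReal_int, toReal_zero, toReal_one,
    show (1 / 2 : ℝ) * φ = φ / 2 by ring, show (1 / 2 : ℝ) * φ⁻¹ = φ⁻¹ / 2 by ring,
    show (1 / 2 : ℝ) * ((2 : ℤ) : ℝ) = 1 by norm_num, mul_one, mul_zero]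

lemma rhombicTriacontahedron_eq : rhombicTriacontahedron =
    convexHull ℝ
      ((fun u => (1 / 2 : ℝ) • toSpace u) '' {u | u ∈ icosahedronPoints ++ dodecahedronPoints}) := by
  have h₁ := signedCyclic_eq (s := 1 / 2) (a := ⟨0, 1⟩) (b := 1) (c := 0) (L := icosahedronPoints)
    (by norm_num) (toReal_phi ▸ Real.goldenRatio_pos.le) (toReal_one ▸ zero_le_one) toReal_zero.ge
    (by decide +kernel) (by decide +kernel)
  have h₂ := signedCyclic_eq (s := 1 / 2) (a := 1) (b := 1) (c := 1)
    (L := dodecahedronPoints.take 8)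
    (by norm_num) (toReal_one ▸ zero_le_one) (toReal_one ▸ zero_le_one) (toReal_one ▸ zero_le_one)
    (by decide +kernel) (by decide +kernel)
  have h₃ := signedCyclic_eq (s := 1 / 2) (a := ⟨0, 1⟩) (b := 0) (c := ⟨-1, 1⟩)
    (L := dodecahedronPoints.drop 8)
    (by norm_num) (toReal_phi ▸ Real.goldenRatio_pos.le) toReal_zero.ge
    (toReal_inv_phi ▸ inv_nonneg.2 Real.goldenRatio_pos.le)
    (by decide +kernel) (by decide +kernel)
  rw [setOf_mem_append, image_union, ← List.take_append_drop 8 dodecahedronPoints,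
    setOf_mem_append, image_union, ← h₁, ← h₂, ← h₃, ← union_assoc, rhombicTriacontahedron,
    toReal_phi, toReal_inv_phi, toReal_zero, toReal_one,
    show (1 / 2 : ℝ) * φ = φ / 2 by ring, show (1 / 2 : ℝ) * φ⁻¹ = φ⁻¹ / 2 by ring,
    mul_one, mul_zero]

/-! ### Verification of the finite conditions -/

lemma geodesicModel_cuboctahedron :
    GeodesicModel cuboctahedronPoints [⟨⟨1, 0⟩, ⟨1, 0⟩, ⟨0, 0⟩⟩, ⟨⟨1, 0⟩, ⟨0, 0⟩, ⟨1, 0⟩⟩,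
      ⟨⟨0, 0⟩, ⟨1, 0⟩, ⟨1, 0⟩⟩] 2 ⟨1, 0⟩ ⟨1, 0⟩ 4 := by
  constructor <;> decide +kernel

lemma geodesicModel_icosidodecahedron :
    GeodesicModel icosidodecahedronPoints
      [⟨⟨2, 0⟩, ⟨0, 0⟩, ⟨0, 0⟩⟩, ⟨⟨0, 0⟩, ⟨2, 0⟩, ⟨0, 0⟩⟩, ⟨⟨0, 0⟩, ⟨0, 0⟩, ⟨2, 0⟩⟩,
        ⟨⟨0, 1⟩, ⟨-1, 1⟩, ⟨1, 0⟩⟩, ⟨⟨1, 0⟩, ⟨0, 1⟩, ⟨-1, 1⟩⟩, ⟨⟨-1, 1⟩, ⟨1, 0⟩, ⟨0, 1⟩⟩]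
      4 ⟨0, 2⟩ ⟨0, 1⟩ 4 := by
  constructor <;> decide +kernel

lemma circuitModel_cuboctahedron : CircuitModel cuboctahedronPoints
    (cuboctahedronCircuit.map fun i => cuboctahedronPoints.getD i ⟨0, 0, 0⟩) ⟨1, 0⟩ := by
  constructor <;> decide +kernel

lemma circuitModel_icosidodecahedron : CircuitModel icosidodecahedronPoints
    (icosidodecahedronCircuit.map fun i => icosidodecahedronPoints.getD i ⟨0, 0, 0⟩) ⟨0, 2⟩ := by
  constructor <;> decide +kernel

lemma exposedModel_octahedron : ExposedModel octahedronPoints := by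
  constructor <;> decide +kernel

lemma exposedModel_rhombicDodecahedron : ExposedModel (octahedronPoints ++ cubePoints) := by
  constructor <;> decide +kernel

lemma exposedModel_icosahedron : ExposedModel icosahedronPoints := by
  constructor <;> decide +kernel

lemma exposedModel_rhombicTriacontahedron :
    ExposedModel (icosahedronPoints ++ dodecahedronPoints) := by
  constructor <;> decide +kernel

lemma cubature_rhombicDodecahedron :
    CubatureModel octahedronPoints cubePoints cuboctahedronPoints ⟨3, 0⟩ ⟨4, 0⟩ ⟨6, 0⟩ 12
      9 2 150 2 := by
  unfold CubatureModel; decide +kernel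

lemma cubature_octahedron :
    CubatureModel octahedronPoints [] cuboctahedronPoints ⟨3, 0⟩ 1 ⟨6, 0⟩ 12 1 2 30 2 := by
  unfold CubatureModel; decide +kernel

/-- The squared norms are `φ + 2`, `3` and `4`, and `(φ + 2)(36 - 12φ) = 3 · 20 = 4 · 15 = 60`. The
weights are `(45/49)/32 = 675/23520` and `(4/49)/30 = 64/23520`; the other three formulas arise in
the same way. -/
lemma cubature_rhombicTriacontahedron :
    CubatureModel icosahedronPoints dodecahedronPoints icosidodecahedronPoints ⟨36, -12⟩ ⟨20, 0⟩
      ⟨15, 0⟩ 60 675 64 23520 4 := by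
  unfold CubatureModel; decide +kernel

lemma cubature_icosahedron :
    CubatureModel icosahedronPoints [] icosidodecahedronPoints ⟨36, -12⟩ 1 ⟨15, 0⟩ 60 25 32 1260
      4 := by
  unfold CubatureModel; decide +kernel

/-! ### Hybrid designs -/

/-- By `mean_pathIntegral` the design identity becomes cubature with weights `β/|X|` and
`(1-β)/|V|`. The bound `t < N` is needed on the great circles, `t ≤ 2 * K + 1` for the moments. -/
theorem edgesVerticesHybrid_of_models {L₁ L₂ L₃ R C : List GoldenPoint} {n Q W₁ W₂ W : ℤ}
    {κ γ μ₁ μ₂ μ₃ : GoldenInt} {r N K t : ℕ} {s s' β : ℝ}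
    (hV : GeodesicModel L₃ R n κ γ r) (hC : CircuitModel L₃ C κ) (hX : ExposedModel (L₁ ++ L₂))
    (hcub : CubatureModel L₁ L₂ L₃ μ₁ μ₂ μ₃ Q W₁ W₂ W K)
    (hr : 0 < r) (hN : 2 < N) (hs0 : 0 < s) (hs : s ^ 2 * n = 1)
    (hγ : 2 * Real.cos (2 * Real.pi / N) = toReal γ) (hκ : 2 * toReal κ = n * toReal γ)
    (hs' : 0 < s') (hQ : Q ≠ 0) (hW : W ≠ 0)
    (h₁ : ∀ u ∈ L₁, dot u u * μ₁ = ⟨Q, 0⟩) (h₂ : ∀ u ∈ L₂, dot u u * μ₂ = ⟨Q, 0⟩)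
    (h₃ : ∀ u ∈ L₃, dot u u * μ₃ = ⟨Q, 0⟩) (htN : t < N) (htK : t ≤ 2 * K + 1)
    (hβ : β ∈ Icc (0 : ℝ) 1) (hβ₁ : β / (L₁ ++ L₂).length = W₁ / W)
    (hβ₂ : (1 - β) / L₃.length = W₂ / W) :
    EdgesVerticesHybrid (convexHull ℝ ((fun u => s • toSpace u) '' {u | u ∈ L₃}))
      (convexHull ℝ ((fun u => s' • toSpace u) '' {u | u ∈ L₁ ++ L₂})) t β := by
  obtain ⟨hinj, hG⟩ := hV.isGeodesicConfiguration hr hN hs0 hs hγ hκ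
  have hnd : (L₃.map fun u => s • toSpace u).Nodup :=
    hV.nodup.map_on fun u hu v hv => hinj hu hv
  have hnorm : ∀ u ∈ L₃, s • toSpace u = normalized u := by
    intro u hu
    rw [normalized, ← NormedSpace.normalize_smul_of_pos hs0,
      hG.normalize_eq (List.mem_toFinset.2 (List.mem_map.2 ⟨u, hu, rfl⟩))]
  rw [← coe_toFinset_map (fun u => s • toSpace u) L₃]
  refine ⟨hC.exists_isEulerCycle hinj (fun u hu v hv huv => ?_) (fun x y hxy => ?_),
    fun v w hw => ?_⟩
  · refine hG.edgeGraph_adj.2 ⟨?_, ?_, ?_⟩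
    · exact Finset.mem_coe.2 (List.mem_toFinset.2 (List.mem_map.2 ⟨u, hu, rfl⟩))
    · exact Finset.mem_coe.2 (List.mem_toFinset.2 (List.mem_map.2 ⟨v, hv, rfl⟩))
    · exact (hV.inner_eq_cos_iff hN hs hγ hκ hu hv).2 huv
  · obtain ⟨hx, hy, hc⟩ := hG.edgeGraph_adj.1 hxy
    obtain ⟨u, hu, rfl⟩ := List.mem_map.1 (List.mem_toFinset.1 (Finset.mem_coe.1 hx))
    obtain ⟨v, hv, rfl⟩ := List.mem_map.1 (List.mem_toFinset.1 (Finset.mem_coe.1 hy))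
    exact ⟨u, hu, v, hv, (hV.inner_eq_cos_iff hN hs hγ hκ hu hv).1 hc, rfl, rfl⟩
  · rw [hX.sphericalVertices_eq hs']
    refine
      { curve := hG.isClosedSphericalCurve hw
        finite := by rw [← coe_toFinset_map]; exact Finset.finite_toSet _
        nonempty := ?_
        subset_sphere := ?_
        beta_mem := hβ
        integrates := fun P hP => ?_ }
    · have hlen := hX.one_lt
      obtain ⟨u, hu⟩ := List.exists_mem_of_length_pos (zero_lt_one.trans hlen)
      exact ⟨_, u, hu, rfl⟩
    · rintro _ ⟨u, hu, rfl⟩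
      rw [mem_sphere_zero_iff_norm]
      exact NormedSpace.norm_normalize (hX.toSpace_ne_zero hu)
    · rw [hG.mean_pathIntegral hw (hP.trans_lt htN), hX.ncard_normalized,
        hX.finsum_normalized (fun x => MvPolynomial.eval (fun i => x i) P),
        List.toFinset_card_of_nodup hnd, List.length_map, hβ₁, hβ₂, List.sum_toFinset _ hnd,
        List.map_map, ← hcub.eval hQ hW h₁ h₂ h₃ (fun d l hl =>
          ⟨sum_normalized_odd hX.nodup hX.flip_mem hl, sum_normalized_odd hV.nodup hV.flip_mem hl⟩)
          (hP.trans htK)]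
      congr 3
      refine List.map_congr_left fun u hu => ?_
      rw [Function.comp_apply, hnorm u hu]

lemma two_mul_cos_hexagon : 2 * Real.cos (2 * Real.pi / (6 : ℕ)) = toReal ⟨1, 0⟩ := by
  have : 2 * Real.pi / (6 : ℕ) = Real.pi / 3 := by
    push_cast
    ring
  rw [this, Real.cos_pi_div_three, toReal_int]
  norm_num

lemma two_mul_cos_decagon : 2 * Real.cos (2 * Real.pi / (10 : ℕ)) = toReal ⟨0, 1⟩ := by
  have : 2 * Real.pi / (10 : ℕ) = Real.pi / 5 := by
    push_cast
    ring
  rw [this, Real.cos_pi_div_five, toReal_phi, Real.goldenRatio]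
  ring

lemma sq_one_div_sqrt_two : (1 / √2 : ℝ) ^ 2 * (2 : ℤ) = 1 := by
  rw [div_pow, Real.sq_sqrt zero_le_two]
  norm_num

theorem cuboctahedron_rhombicDodecahedron :
    EdgesVerticesHybrid cuboctahedron rhombicDodecahedron 5 (21 / 25) := by
  rw [cuboctahedron_eq, rhombicDodecahedron_eq]
  exact edgesVerticesHybrid_of_models (N := 6) geodesicModel_cuboctahedron
    circuitModel_cuboctahedron exposedModel_rhombicDodecahedron cubature_rhombicDodecahedron
    (by norm_num) (by norm_num) (by positivity) sq_one_div_sqrt_two two_mul_cos_hexagon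
    (by norm_num [toReal_int]) (by norm_num) (by norm_num) (by norm_num) (by decide +kernel)
    (by decide +kernel) (by decide +kernel) (by norm_num) (by norm_num) (by norm_num)
    (by norm_num [octahedronPoints, cubePoints]) (by norm_num [cuboctahedronPoints])

theorem cuboctahedron_octahedron :
    EdgesVerticesHybrid cuboctahedron octahedron 5 (1 / 5) := by
  -- All vertices have the same norm here, so the second list is empty.
  rw [cuboctahedron_eq, octahedron_eq, ← List.append_nil octahedronPoints]
  exact edgesVerticesHybrid_of_models (N := 6) geodesicModel_cuboctahedron
    circuitModel_cuboctahedron ((List.append_nil octahedronPoints).symm ▸ exposedModel_octahedron)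
    cubature_octahedron
    (by norm_num) (by norm_num) (by positivity) sq_one_div_sqrt_two two_mul_cos_hexagon
    (by norm_num [toReal_int]) (by norm_num) (by norm_num) (by norm_num) (by decide +kernel)
    (by simp) (by decide +kernel) (by norm_num) (by norm_num) (by norm_num)
    (by norm_num [octahedronPoints]) (by norm_num [cuboctahedronPoints])

theorem icosidodecahedron_rhombicTriacontahedron :
    EdgesVerticesHybrid icosidodecahedron rhombicTriacontahedron 9 (45 / 49) := by
  rw [icosidodecahedron_eq, rhombicTriacontahedron_eq]
  exact edgesVerticesHybrid_of_models (N := 10) geodesicModel_icosidodecahedron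
    circuitModel_icosidodecahedron exposedModel_rhombicTriacontahedron
    cubature_rhombicTriacontahedron
    (by norm_num) (by norm_num) (by norm_num) (by norm_num) two_mul_cos_decagon
    (by simp [toReal]; ring) (by norm_num) (by norm_num) (by norm_num) (by decide +kernel)
    (by decide +kernel) (by decide +kernel) (by norm_num) (by norm_num) (by norm_num)
    (by norm_num [icosahedronPoints, dodecahedronPoints]) (by norm_num [icosidodecahedronPoints])

theorem icosidodecahedron_icosahedron :
    EdgesVerticesHybrid icosidodecahedron icosahedron 9 (5 / 21) := by
  rw [icosidodecahedron_eq, icosahedron_eq, ← List.append_nil icosahedronPoints]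
  exact edgesVerticesHybrid_of_models (N := 10) geodesicModel_icosidodecahedron
    circuitModel_icosidodecahedron
    ((List.append_nil icosahedronPoints).symm ▸ exposedModel_icosahedron) cubature_icosahedron
    (by norm_num) (by norm_num) (by norm_num) (by norm_num) two_mul_cos_decagon
    (by simp [toReal]; ring) (by norm_num) (by norm_num) (by norm_num) (by decide +kernel)
    (by simp) (by decide +kernel) (by norm_num) (by norm_num) (by norm_num)
    (by norm_num [icosahedronPoints]) (by norm_num [icosidodecahedronPoints])

end HybridDesign

end

theorem mainTheorem7 :
    HybridDesign.EdgesVerticesHybrid HybridDesign.cuboctahedron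
      HybridDesign.rhombicDodecahedron 5 (21 / 25) ∧
    HybridDesign.EdgesVerticesHybrid HybridDesign.cuboctahedron
      HybridDesign.octahedron 5 (1 / 5) ∧
    HybridDesign.EdgesVerticesHybrid HybridDesign.icosidodecahedron
      HybridDesign.rhombicTriacontahedron 9 (45 / 49) ∧
    HybridDesign.EdgesVerticesHybrid HybridDesign.icosidodecahedron
      HybridDesign.icosahedron 9 (5 / 21) :=
  ⟨HybridDesign.cuboctahedron_rhombicDodecahedron, HybridDesign.cuboctahedron_octahedron,
    HybridDesign.icosidodecahedron_rhombicTriacontahedron,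
    HybridDesign.icosidodecahedron_icosahedron⟩
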